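/- Let $d\ge 1$ and let $\{X_{nj}: n\in\mathbb N,\ j\in\mathbb Z^d\}$ be real random variables with mean zero on a probability space $(\Omega,\mathcal F,P)$ such that, for each $n$, the variables $X_{nj}$, $j\in\mathbb Z^d$, are independent. For each $n$ let $H_n>0$ be such that, for every $j$, $\mathbb E e^{zX_{nj}}$ is finite for all complex $|z|<H_n$ and the cumulant generating function $L_{nj}(z)=\log \mathbb E e^{zX_{nj}}$ (the logarithm normalised by $L_{nj}(0)=0$) is analytic in the disc $|z|<H_n$. Let $\gamma_{3nj}$ be the third cumulant of $X_{nj}$, i.e. the third derivative of $L_{nj}$ at $0$. Put $$S_n=\sum_{j\in\mathbb Z^d}X_{nj},\qquad B_n=\sum_{j\in\mathbb Z^d}\mathbb E X_{nj}^2,\qquad F_n(x)=P\big(S_n<x\sqrt{B_n}\big),$$ where $B_n<\infty$ for each $n$ and $S_n$ is the limit in probability, as $m\to\infty$, of the partial sums over $[-m,m]^d\cap\mathbb Z^d$. Let $\Phi$ be the standard normal distribution function. Suppose that there are constants $c_{nj}\ge 0$ with $|L_{nj}(z)|\le c_{nj}$ for all $n$, $j$ and all complex $|z|<H_n$, that $C_n:=\sum_{j\in\mathbb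 Z^d}c_{nj}<\infty$ for each $n$, and that, as $n\to\infty$, $B_nH_n^2\to\infty$ and $C_n=O(B_nH_n^2)$. Suppose moreover that $\sum_{j\in\mathbb Z^d}\gamma_{3nj}=0$ for all $n$. Then, for $x\ge 0$ with $x=O\big((H_n\sqrt{B_n})^{1/3}\big)$, $$F_n(x)-\Phi(x)=O\Big(\frac{e^{-x^2/2}}{H_n\sqrt{B_n}}\Big)\qquad (n\to\infty),$$ that is: for every $K$ there are $C$ and $N$ such that for all $n\ge N$ and all $x$ with $0\le x\le K(H_n\sqrt{B_n})^{1/3}$, $$|F_n(x)-\Phi(x)|\le C\,\frac{e^{-x^2/2}}{H_n\sqrt{B_n}}.$$ -/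

import Mathlib

open MeasureTheory ProbabilityTheory Filter Topology

noncomputable section

/-- `L` is the complex cumulant generating function `z ↦ log 𝔼 exp (z Y)` of the random variable `Y`
on the disc `|z| < r`: the exponential moments are finite there, and `L` is the analytic
logarithm of `𝔼 exp (z Y)` normalised by `L 0 = 0`. These properties determine `L` uniquely on
the disc. -/
structure IsComplexCGF {Ω : Type*} [MeasurableSpace Ω] (P : Measure Ω) (Y : Ω → ℝ) (r : ℝ)
    (L : ℂ → ℂ) : Prop where
  integrable_exp : ∀ z ∈ Metric.ball (0 : ℂ) r, Integrable (fun ω => Complex.exp (z * Y ω)) P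
  analytic : AnalyticOnNhd ℂ L (Metric.ball (0 : ℂ) r)
  map_zero : L 0 = 0
  exp_eq : ∀ z ∈ Metric.ball (0 : ℂ) r, Complex.exp (L z) = complexMGF Y P z

/-- The cumulant of order `k` of `Y`: the `k`-th derivative at `0` of `t ↦ log 𝔼 exp (t Y)`. -/
def cumulant {Ω : Type*} [MeasurableSpace Ω] (P : Measure Ω) (Y : Ω → ℝ) (k : ℕ) : ℝ :=
  iteratedDeriv k (cgf Y P) 0

/-- The lattice cube `[-m, m]^d ∩ ℤ^d`. -/
def latticeCube (d m : ℕ) : Finset (Fin d → ℤ) :=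
  Finset.Icc (fun _ => -(m : ℤ)) (fun _ => (m : ℤ))

/-- `S` is the sum `∑_{j ∈ ℤ^d} Y j`, the limit in probability of the partial sums over the
lattice cubes `[-m, m]^d ∩ ℤ^d` as `m → ∞`. -/
def IsFieldSum {Ω : Type*} [MeasurableSpace Ω] (P : Measure Ω) {d : ℕ}
    (Y : (Fin d → ℤ) → Ω → ℝ) (S : Ω → ℝ) : Prop :=
  TendstoInMeasure P (fun (m : ℕ) ω => ∑ j ∈ latticeCube d m, Y j ω) atTop S

/-- The sum of the variances `∑_{j ∈ ℤ^d} Var (Y j)`. -/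
def fieldVariance {Ω : Type*} [MeasurableSpace Ω] (P : Measure Ω) {d : ℕ}
    (Y : (Fin d → ℤ) → Ω → ℝ) : ℝ :=
  ∑' j, Var[Y j; P]

/-- The left-continuous distribution function `x ↦ P (S < x √B)`. -/
def normalizedCDF {Ω : Type*} [MeasurableSpace Ω] (P : Measure Ω) (S : Ω → ℝ) (B x : ℝ) : ℝ :=
  P.real {ω | S ω < x * √B}

/-- The standard normal distribution function `Φ`. -/
def stdNormalCDF (x : ℝ) : ℝ := cdf (gaussianReal 0 1) x

end

/-! The proof is Cramér's exponential tilting combined with Esseen's smoothing inequality. Fix `n`,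
write `σ = √B`, and let `μ` be the law of `S/σ`. On the disc of radius `T = Hσ/2` its moment
generating function is `exp (z²/2 + r z)`, where `r` is analytic and `O(T²)`. The first two
cumulants of `S/σ` are 0 and 1, and the third vanishes because the `γ₃` sum to zero, so `r` vanishes
to fourth order at 0. Cauchy's estimates then give `r z = O(|z|⁴/T²)` and `r' z = O(|z|³/T²)` on
half the disc.

Tilt `μ` by `exp (x y)` and translate by `-x` to get a law `Q`. Then `μ [x, ∞) = exp (-x²/2 + r x)
∫_{v ≥ 0} exp (-x v) dQ`, and the same identity holds for the standard normal law with `r = 0` and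
with `Q` again standard normal. Two comparisons remain, both under `x³ = O(T)`. First, `r x =
O(x/T)`, and the factor `x` is absorbed because the Gaussian integral is at most `1/x`. Second, the
characteristic function of `Q` is `exp (-t²/2 + r (x + it) - r x)`, and the derivative bound makes
the correction `O(|t| (1 + t²)/T)`; Esseen's inequality on `|t| ≤ δT` turns this into a Kolmogorov
distance `O(1/T)` between `Q` and the normal law, which transfers to the integrals of `exp (-x v)`.
The prefactor `exp (-x²/2)` is common to both tails, which gives the stated error.

The carrying lemmas are `exists_abs_cdf_sub_le_of_charFun` (Esseen),
`measureReal_Ici_eq_tiltedShift` (tilting), `norm_charFun_tiltedShift_sub_le` and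
`exists_abs_measureReal_Iio_sub_stdNormalCDF_le` (one law), and `complexMGF_fieldSum` (passage to
the infinite sum). -/

/-! ### The Fejér kernel. -/

/-- The Fejér kernel, as the Fourier transform of the triangle function. -/
noncomputable def fejerKernel (u : ℝ) : ℝ := ∫ t in (-1 : ℝ)..1, (1 - |t|) * Real.cos (t * u)

theorem fejerKernel_continuous : Continuous fejerKernel := by
  unfold fejerKernel
  apply intervalIntegral.continuous_parametric_intervalIntegral_of_continuous'
  fun_prop

theorem fejerKernel_neg (u : ℝ) : fejerKernel (-u) = fejerKernel u := by
  simp [fejerKernel]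

theorem fejerKernel_eq {u : ℝ} (hu : u ≠ 0) : fejerKernel u = 2 * (1 - Real.cos u) / u ^ 2 := by
  have hc : Continuous fun t : ℝ => (1 - |t|) * Real.cos (t * u) := by fun_prop
  have h1 : ∫ t in (0 : ℝ)..1, (1 - |t|) * Real.cos (t * u) = (1 - Real.cos u) / u ^ 2 := by
    have : ∫ t in (0 : ℝ)..1, (1 - |t|) * Real.cos (t * u)
        = ∫ t in (0 : ℝ)..1, (1 - t) * Real.cos (t * u) := by
      apply intervalIntegral.integral_congr
      intro t ht
      rw [Set.uIcc_of_le zero_le_one] at ht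
      simp [abs_of_nonneg ht.1]
    rw [this, intervalIntegral.integral_eq_sub_of_hasDerivAt
      (f := fun t => (1 - t) * Real.sin (t * u) / u - Real.cos (t * u) / u ^ 2)]
    · simp; field_simp; ring
    · intro t _
      have h2 : HasDerivAt (fun t : ℝ => t * u) u t := by
        simpa using (hasDerivAt_id t).mul_const u
      have h3 : HasDerivAt (fun t : ℝ => 1 - t) (-1) t := by
        simpa using (hasDerivAt_id t).const_sub 1
      refine HasDerivAt.congr_deriv
        (((h3.mul h2.sin).div_const u).sub (h2.cos.div_const (u ^ 2))) ?_
      field_simp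
      ring
    · exact (by fun_prop : Continuous fun t : ℝ => (1 - t) * Real.cos (t * u)).intervalIntegrable _ _
  have h2 : ∫ t in (-1 : ℝ)..0, (1 - |t|) * Real.cos (t * u) = (1 - Real.cos u) / u ^ 2 := by
    rw [← h1]
    simpa using (intervalIntegral.integral_comp_neg (a := 0) (b := 1)
      (fun t : ℝ => (1 - |t|) * Real.cos (t * u))).symm
  rw [fejerKernel, ← intervalIntegral.integral_add_adjacent_intervals
    (hc.intervalIntegrable (-1) 0) (hc.intervalIntegrable 0 1), h1, h2]
  ring

theorem fejerKernel_nonneg (u : ℝ) : 0 ≤ fejerKernel u := by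
  by_cases hu : u = 0
  · subst hu
    apply intervalIntegral.integral_nonneg (by norm_num)
    intro t ht
    have := abs_le.2 ht
    simpa using this
  · rw [fejerKernel_eq hu]
    have := Real.cos_le_one u
    apply div_nonneg _ (sq_nonneg u)
    linarith

theorem fejerKernel_le (u : ℝ) : fejerKernel u ≤ 8 * (1 + u ^ 2)⁻¹ := by
  rw [← div_eq_mul_inv, le_div_iff₀ (by positivity)]
  rcases le_total 1 |u| with h | h
  · have hu : u ≠ 0 := by rintro rfl; norm_num at h
    have h1 : 1 ≤ u ^ 2 := by rw [← sq_abs]; nlinarith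
    rw [fejerKernel_eq hu, div_mul_eq_mul_div, div_le_iff₀ (by positivity)]
    nlinarith [Real.neg_one_le_cos u, Real.cos_le_one u]
  · have h1 : u ^ 2 ≤ 1 := by rw [← sq_abs]; nlinarith [abs_nonneg u]
    have h2 : fejerKernel u ≤ 2 := by
      have : ‖fejerKernel u‖ ≤ 1 * |1 - (-1 : ℝ)| := by
        apply intervalIntegral.norm_integral_le_of_norm_le_const
        intro t ht
        rw [Set.uIoc_of_le (by norm_num)] at ht
        have h3 : |t| ≤ 1 := abs_le.2 ⟨ht.1.le, ht.2⟩
        rw [norm_mul, Real.norm_eq_abs, Real.norm_eq_abs]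
        have h4 : abs (1 - |t|) ≤ 1 := abs_le.2 ⟨by linarith, by linarith [abs_nonneg t]⟩
        nlinarith [Real.abs_cos_le_one (t * u), abs_nonneg (1 - |t|), abs_nonneg (Real.cos (t * u))]
      norm_num at this
      exact (le_abs_self _).trans this
    nlinarith [fejerKernel_nonneg u]

theorem fejerKernel_integrable : Integrable fejerKernel := by
  apply (integrable_inv_one_add_sq.const_mul 8).mono'
    fejerKernel_continuous.aestronglyMeasurable
  filter_upwards with u
  rw [Real.norm_eq_abs, abs_of_nonneg (fejerKernel_nonneg u)]
  exact fejerKernel_le u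

theorem fejerKernel_integral_pos : 0 < ∫ u, fejerKernel u := by
  apply integral_pos_of_integrable_nonneg_nonzero (x := Real.pi) fejerKernel_continuous
    fejerKernel_integrable fejerKernel_nonneg
  rw [fejerKernel_eq Real.pi_ne_zero]
  have := Real.pi_ne_zero
  simp [this]

theorem fejerKernel_eq_complex (u : ℝ) :
    (fejerKernel u : ℂ)
      = ∫ t in (-1 : ℝ)..1, ((1 - |t| : ℝ) : ℂ) * Complex.exp (t * u * Complex.I) := by
  have hs : ∫ t in (-1 : ℝ)..1, (1 - |t|) * Real.sin (t * u) = 0 := by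
    have := intervalIntegral.integral_comp_neg (a := -1) (b := 1)
      (fun t : ℝ => (1 - |t|) * Real.sin (t * u))
    simp at this
    linarith
  have hc : ∀ t : ℝ, ((1 - |t| : ℝ) : ℂ) * Complex.exp (t * u * Complex.I)
      = (((1 - |t|) * Real.cos (t * u) : ℝ) : ℂ)
        + (((1 - |t|) * Real.sin (t * u) : ℝ) : ℂ) * Complex.I := by
    intro t
    rw [Complex.exp_mul_I]
    push_cast
    ring
  simp_rw [hc]
  rw [intervalIntegral.integral_add, intervalIntegral.integral_mul_const,
    intervalIntegral.integral_ofReal, intervalIntegral.integral_ofReal, hs]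
  · simp [fejerKernel]
  · exact (by fun_prop : Continuous _).intervalIntegrable _ _
  · exact (by fun_prop : Continuous _).intervalIntegrable _ _

/-- Any fraction above 1/2 would serve: the mass near 0 must outweigh the mass outside in
`le_of_smoothed_le`. -/
theorem exists_fejerKernel_mass :
    ∃ η : ℝ, 0 < η ∧ 3 / 4 * ∫ u, fejerKernel u ≤ ∫ u in -η..η, fejerKernel u := by
  have h := intervalIntegral_tendsto_integral fejerKernel_integrable
    tendsto_neg_atTop_atBot tendsto_id
  have h2 := h.eventually_const_le (u := 3 / 4 * ∫ u, fejerKernel u)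
    (by linarith [fejerKernel_integral_pos])
  obtain ⟨η, h3, h4⟩ := (h2.and (eventually_gt_atTop 0)).exists
  exact ⟨η, h4, h3⟩

/-! ### Fejér smoothing of a law. -/

/-- The smoothed density of a law, in terms of its characteristic function. -/
theorem integral_fejerKernel_sub (μ : Measure ℝ) [IsProbabilityMeasure μ] (s : ℝ) :
    ((∫ y, fejerKernel (s - y) ∂μ : ℝ) : ℂ)
      = ∫ t in (-1 : ℝ)..1,
          ((1 - |t| : ℝ) : ℂ) * charFun μ t * Complex.exp (-(t * s * Complex.I)) := by
  have h1 : ∀ y : ℝ, (fejerKernel (s - y) : ℂ) = ∫ t in Set.Ioc (-1 : ℝ) 1,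
      ((1 - |t| : ℝ) : ℂ) * Complex.exp (t * (y - s) * Complex.I) := by
    intro y
    rw [← fejerKernel_neg, fejerKernel_eq_complex,
      intervalIntegral.integral_of_le (by norm_num)]
    simp
  rw [← integral_complex_ofReal]
  simp_rw [h1]
  rw [integral_integral_swap, intervalIntegral.integral_of_le (by norm_num)]
  · congr 1
    ext t
    rw [charFun_apply_real, mul_assoc, ← integral_mul_const, ← integral_const_mul]
    congr 1
    ext y
    rw [← Complex.exp_add]
    congr 2
    ring
  · have hm : Continuous (Function.uncurry fun (y t : ℝ) =>
        ((1 - |t| : ℝ) : ℂ) * Complex.exp (t * (y - s) * Complex.I)) := by fun_prop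
    have hb : ∀ᵐ p : ℝ × ℝ ∂(μ.prod (volume.restrict (Set.Ioc (-1 : ℝ) 1))),
        p.2 ∈ Set.Ioc (-1 : ℝ) 1 := by
      have : ∀ᵐ t ∂(volume.restrict (Set.Ioc (-1 : ℝ) 1)), t ∈ Set.Ioc (-1 : ℝ) 1 :=
        ae_restrict_mem measurableSet_Ioc
      exact Measure.quasiMeasurePreserving_snd.ae this
    refine Integrable.of_bound hm.aestronglyMeasurable 1 ?_
    filter_upwards [hb] with p hp
    have h3 : |p.2| ≤ 1 := abs_le.2 ⟨hp.1.le, hp.2⟩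
    have h4 : abs (1 - |p.2|) ≤ 1 := abs_le.2 ⟨by linarith, by linarith [abs_nonneg p.2]⟩
    have h5 : ‖Complex.exp (p.2 * (p.1 - s) * Complex.I)‖ = 1 := by
      have := Complex.norm_exp_ofReal_mul_I (p.2 * (p.1 - s))
      push_cast at this
      exact this
    rw [Function.uncurry, norm_mul, h5, mul_one, Complex.norm_real]
    exact h4

/-- The bound does not depend on the interval, so the left endpoint can later go to `-∞`. The factor
`1/|t|` is the one that the hypothesis `‖charFun μ t - charFun ν t‖ ≤ |t| * w t` cancels. -/
theorem norm_integral_exp_le (a b : ℝ) {t : ℝ} (ht : t ≠ 0) :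
    ‖∫ s in a..b, Complex.exp (-(t * s * Complex.I))‖ ≤ 2 / |t| := by
  have hne : (-(t * Complex.I) : ℂ) ≠ 0 := by simp [ht]
  have : (fun s : ℝ => Complex.exp (-(t * s * Complex.I)))
      = fun s : ℝ => Complex.exp (-(t * Complex.I) * s) := by
    ext s; congr 1; ring
  rw [this, integral_exp_mul_complex hne, norm_div]
  have hn : ∀ s : ℝ, ‖Complex.exp (-(t * Complex.I) * s)‖ = 1 := by
    intro s
    have := Complex.norm_exp_ofReal_mul_I (-(t * s))
    push_cast at this
    rw [← this]; congr 2; ring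
  have h2 : ‖(-(t * Complex.I) : ℂ)‖ = |t| := by simp
  rw [h2]
  gcongr
  calc _ ≤ ‖Complex.exp (-(t * Complex.I) * b)‖ + ‖Complex.exp (-(t * Complex.I) * a)‖ :=
        norm_sub_le _ _
    _ = 2 := by rw [hn, hn]; norm_num

theorem continuous_integral_fejerKernel_sub (μ : Measure ℝ) [IsProbabilityMeasure μ] :
    Continuous fun s => ∫ y, fejerKernel (s - y) ∂μ := by
  apply continuous_of_dominated (bound := fun _ => 8)
  · intro s
    exact (fejerKernel_continuous.comp (by fun_prop)).aestronglyMeasurable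
  · intro s
    filter_upwards with y
    rw [Real.norm_eq_abs, abs_of_nonneg (fejerKernel_nonneg _)]
    refine (fejerKernel_le _).trans ?_
    have : (1 + (s - y) ^ 2)⁻¹ ≤ 1 := inv_le_one_of_one_le₀ (by nlinarith [sq_nonneg (s - y)])
    linarith
  · exact integrable_const _
  · filter_upwards with y
    exact fejerKernel_continuous.comp (by fun_prop)

theorem abs_integral_smoothed_sub_le (μ ν : Measure ℝ) [IsProbabilityMeasure μ]
    [IsProbabilityMeasure ν] {w : ℝ → ℝ} (hw : IntervalIntegrable w volume (-1) 1)
    (h : ∀ t, |t| ≤ 1 → ‖charFun μ t - charFun ν t‖ ≤ |t| * w t) (a b : ℝ) :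
    |(∫ s in a..b, ∫ y, fejerKernel (s - y) ∂μ) - ∫ s in a..b, ∫ y, fejerKernel (s - y) ∂ν|
      ≤ 2 * ∫ t in (-1 : ℝ)..1, w t := by
  have hcμ : Continuous (charFun μ) := continuous_charFun
  have hcν : Continuous (charFun ν) := continuous_charFun
  rw [← intervalIntegral.integral_sub
    ((continuous_integral_fejerKernel_sub μ).intervalIntegrable _ _)
    ((continuous_integral_fejerKernel_sub ν).intervalIntegrable _ _),
    ← Real.norm_eq_abs, ← Complex.norm_real, ← intervalIntegral.integral_ofReal]
  have h1 : ∀ s : ℝ, (((∫ y, fejerKernel (s - y) ∂μ) - ∫ y, fejerKernel (s - y) ∂ν : ℝ) : ℂ)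
      = ∫ t in (-1 : ℝ)..1, ((1 - |t| : ℝ) : ℂ) * (charFun μ t - charFun ν t)
        * Complex.exp (-(t * s * Complex.I)) := by
    intro s
    rw [Complex.ofReal_sub, integral_fejerKernel_sub, integral_fejerKernel_sub,
      ← intervalIntegral.integral_sub]
    · congr 1; ext t; ring
    · exact (by fun_prop : Continuous _).intervalIntegrable _ _
    · exact (by fun_prop : Continuous _).intervalIntegrable _ _
  simp_rw [h1]
  rw [intervalIntegral_intervalIntegral_swap]
  · simp_rw [intervalIntegral.integral_const_mul]
    rw [← intervalIntegral.integral_const_mul]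
    apply intervalIntegral.norm_integral_le_of_norm_le (by norm_num) _ (hw.const_mul 2)
    filter_upwards [Measure.ae_ne volume (0 : ℝ)] with t ht0 ht
    have h3 : |t| ≤ 1 := abs_le.2 ⟨ht.1.le, ht.2⟩
    have h4 : abs (1 - |t|) ≤ 1 := abs_le.2 ⟨by linarith, by linarith [abs_nonneg t]⟩
    have h5 := norm_integral_exp_le a b ht0
    have h6 := h t h3
    have h7 : 0 < |t| := abs_pos.2 ht0
    rw [norm_mul, norm_mul, Complex.norm_real, Real.norm_eq_abs]
    calc abs (1 - |t|) * ‖charFun μ t - charFun ν t‖ * ‖∫ s in a..b, Complex.exp (-(t * s * Complex.I))‖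
        ≤ 1 * (|t| * w t) * (2 / |t|) := by
          gcongr
          exact mul_nonneg zero_le_one ((norm_nonneg _).trans h6)
      _ = 2 * w t := by field_simp
  · have hc : Continuous (Function.uncurry fun s t : ℝ => ((1 - |t| : ℝ) : ℂ) *
        (charFun μ t - charFun ν t) * Complex.exp (-(t * s * Complex.I))) := by fun_prop
    exact (hc.continuousOn.integrableOn_compact (isCompact_uIcc.prod isCompact_uIcc)).mono_set
      (Set.prod_mono Set.uIoc_subset_uIcc Set.uIoc_subset_uIcc)

theorem integral_smoothed_eq (μ : Measure ℝ) [IsProbabilityMeasure μ] {a b : ℝ} (hab : a ≤ b) :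
    ∫ s in a..b, ∫ y, fejerKernel (s - y) ∂μ
      = ∫ v, fejerKernel v * μ.real (Set.Ioc (a - v) (b - v)) := by
  have hk := fejerKernel_continuous
  rw [intervalIntegral.integral_of_le hab, integral_integral_swap]
  · have h1 : ∀ y : ℝ, ∫ s in Set.Ioc a b, fejerKernel (s - y)
        = ∫ v, (Set.Ioc a b).indicator (fun _ => (1 : ℝ)) (v + y) * fejerKernel v := by
      intro y
      rw [← integral_indicator measurableSet_Ioc,
        ← integral_add_right_eq_self _ y]
      congr 1
      ext v
      by_cases hv : v + y ∈ Set.Ioc a b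
      · rw [Set.indicator_of_mem hv, Set.indicator_of_mem hv]; simp
      · rw [Set.indicator_of_notMem hv, Set.indicator_of_notMem hv]; simp
    simp_rw [h1]
    rw [integral_integral_swap]
    · congr 1
      ext v
      rw [integral_mul_const, mul_comm]
      congr 1
      have : (fun y => (Set.Ioc a b).indicator (fun _ => (1 : ℝ)) (v + y))
          = (Set.Ioc (a - v) (b - v)).indicator (fun _ => (1 : ℝ)) := by
        ext y
        have : v + y ∈ Set.Ioc a b ↔ y ∈ Set.Ioc (a - v) (b - v) := by
          simp only [Set.mem_Ioc]
          constructor <;> rintro ⟨h1, h2⟩ <;> constructor <;> linarith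
        simp only [Set.indicator, this]
      rw [this, integral_indicator measurableSet_Ioc]
      simp
    · have hi : Integrable (fun p : ℝ × ℝ => fejerKernel p.2) (μ.prod volume) :=
        fejerKernel_integrable.comp_snd μ
      apply hi.mono'
      · refine Measurable.aestronglyMeasurable (Measurable.mul ?_ ?_)
        · exact (measurable_const.indicator measurableSet_Ioc).comp (by fun_prop)
        · exact hk.measurable.comp measurable_snd
      · filter_upwards with p
        rw [Function.uncurry, norm_mul, Real.norm_eq_abs (fejerKernel _),
          abs_of_nonneg (fejerKernel_nonneg _)]
        apply mul_le_of_le_one_left (fejerKernel_nonneg _)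
        by_cases hv : p.2 + p.1 ∈ Set.Ioc a b <;> simp [Set.indicator, hv]
  · refine Integrable.of_bound (C := 8) ?_ ?_
    · exact (hk.comp (by fun_prop)).aestronglyMeasurable
    · filter_upwards with p
      rw [Function.uncurry, Real.norm_eq_abs, abs_of_nonneg (fejerKernel_nonneg _)]
      refine (fejerKernel_le _).trans ?_
      have : (1 + (p.1 - p.2) ^ 2)⁻¹ ≤ 1 := inv_le_one_of_one_le₀ (by nlinarith [sq_nonneg (p.1 - p.2)])
      linarith

/-! ### Removing the smoothing; Esseen's inequality. -/

/-- As `D` falls with slope at most `m`, it stays above `D x - 2mη` on `[x, x + 2η]`. Averaging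
against the kernel centred at `x + η`, at least 3/4 of the mass sees this lower bound and the rest
sees at worst `-Δ`. -/
theorem le_of_smoothed_le {D : ℝ → ℝ} {m Δ ε η : ℝ} (hm : 0 ≤ m) (hη : 0 < η) (hε0 : 0 ≤ ε)
    (hmass : 3 / 4 * ∫ u, fejerKernel u ≤ ∫ u in -η..η, fejerKernel u)
    (hD : Measurable D) (hΔ : ∀ x, |D x| ≤ Δ)
    (hmono : ∀ x y, x ≤ y → D x - m * (y - x) ≤ D y)
    (hε : ∀ b, ∫ v, fejerKernel v * D (b - v) ≤ ε) (x : ℝ) :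
    D x ≤ 2 * m * η + 4 / 3 * (ε / ∫ u, fejerKernel u) + Δ / 3 := by
  set c := ∫ u, fejerKernel u with hc
  have hc0 : 0 < c := fejerKernel_integral_pos
  set p := ∫ u in -η..η, fejerKernel u with hp
  have hint : Integrable fun v => fejerKernel v * D (x + η - v) := by
    refine fejerKernel_integrable.mul_bdd (c := Δ) ?_ ?_
    · exact (hD.comp (by fun_prop)).aestronglyMeasurable
    · filter_upwards with v using hΔ _
  have hmem : MeasurableSet (Set.Ioc (-η) η) := measurableSet_Ioc
  have hp' : p = ∫ u in Set.Ioc (-η) η, fejerKernel u :=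
    intervalIntegral.integral_of_le (by linarith)
  have hsplit : p + ∫ u in (Set.Ioc (-η) η)ᶜ, fejerKernel u = c := by
    rw [hp']; exact integral_add_compl hmem fejerKernel_integrable
  have hpos : 0 ≤ ∫ u in (Set.Ioc (-η) η)ᶜ, fejerKernel u :=
    setIntegral_nonneg hmem.compl fun u _ => fejerKernel_nonneg u
  have hin : (D x - 2 * m * η) * p ≤ ∫ v in Set.Ioc (-η) η, fejerKernel v * D (x + η - v) := by
    rw [hp', ← integral_const_mul]
    apply setIntegral_mono_on (fejerKernel_integrable.const_mul _).integrableOn hint.integrableOn hmem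
    intro v hv
    rw [mul_comm]
    apply mul_le_mul_of_nonneg_left _ (fejerKernel_nonneg v)
    have := hmono x (x + η - v) (by linarith [hv.2])
    nlinarith [hv.1]
  have hout : -Δ * (c - p) ≤ ∫ v in (Set.Ioc (-η) η)ᶜ, fejerKernel v * D (x + η - v) := by
    rw [← hsplit, add_sub_cancel_left, ← integral_const_mul]
    apply setIntegral_mono_on (fejerKernel_integrable.const_mul _).integrableOn hint.integrableOn
      hmem.compl
    intro v hv
    rw [mul_comm]
    apply mul_le_mul_of_nonneg_left _ (fejerKernel_nonneg v)
    exact (abs_le.1 (hΔ _)).1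
  have htot : (D x - 2 * m * η) * p - Δ * (c - p) ≤ ε := by
    have := hε (x + η)
    rw [← integral_add_compl hmem hint] at this
    linarith
  have hΔ0 : 0 ≤ Δ := (abs_nonneg _).trans (hΔ x)
  have hε' : ε / c * c = ε := div_mul_cancel₀ _ hc0.ne'
  have he0 : 0 ≤ ε / c := div_nonneg hε0 hc0.le
  -- Replacing `p` by `3c/4` needs a nonnegative factor; in the other case the claim is trivial.
  rcases le_or_gt 0 (D x - 2 * m * η) with h | h
  · have h1 : (D x - 2 * m * η) * (3 / 4 * c) ≤ (D x - 2 * m * η) * p := by gcongr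
    have h2 : Δ * (c - p) ≤ Δ * (c / 4) := by gcongr; linarith
    have h3 : c * (3 / 4 * (D x - 2 * m * η) - Δ / 4) ≤ c * (ε / c) := by linarith
    have h4 := le_of_mul_le_mul_left h3 hc0
    linarith
  · linarith

theorem abs_le_of_smoothed_le {D : ℝ → ℝ} {m Δ ε η : ℝ} (hm : 0 ≤ m) (hη : 0 < η) (hε0 : 0 ≤ ε)
    (hmass : 3 / 4 * ∫ u, fejerKernel u ≤ ∫ u in -η..η, fejerKernel u)
    (hD : Measurable D) (hΔ : ∀ x, |D x| ≤ Δ)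
    (hmono : ∀ x y, x ≤ y → D x - m * (y - x) ≤ D y)
    (hε : ∀ b, |∫ v, fejerKernel v * D (b - v)| ≤ ε) (x : ℝ) :
    |D x| ≤ 3 * m * η + 2 * (ε / ∫ u, fejerKernel u) := by
  have key : ∀ Δ : ℝ, (∀ x, |D x| ≤ Δ) →
      ∀ x, |D x| ≤ 2 * m * η + 4 / 3 * (ε / ∫ u, fejerKernel u) + Δ / 3 := by
    intro Δ hΔ x
    rw [abs_le']
    refine ⟨le_of_smoothed_le hm hη hε0 hmass hD hΔ hmono (fun b => (abs_le.1 (hε b)).2) x, ?_⟩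
    -- The reflection `y ↦ -D (-y)` obeys the same one-sided slope bound, and the kernel is even.
    have h := le_of_smoothed_le (D := fun y => -D (-y)) (Δ := Δ) hm hη hε0 hmass
      (hD.comp measurable_neg).neg (by simpa using fun x => hΔ (-x)) ?_ ?_ (-x)
    · simpa using h
    · intro a b hab
      have := hmono (-b) (-a) (by linarith)
      linarith
    · intro b
      have h1 := integral_neg_eq_self (fun v => fejerKernel v * D (-b - v)) volume
      have h2 : ∫ v, fejerKernel v * -D (-(b - v)) = -∫ v, fejerKernel v * D (-b - v) := by
        rw [← h1, ← integral_neg]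
        congr 1
        ext v
        rw [fejerKernel_neg]
        ring_nf
      rw [h2]
      exact (neg_le_abs _).trans (hε _)
  have hbdd : BddAbove (Set.range fun x => |D x|) := ⟨Δ, by rintro _ ⟨x, rfl⟩; exact hΔ x⟩
  -- With `Δ` the supremum of `|D|`, the term `Δ/3` is absorbed on the left, which multiplies the
  -- other constants by 3/2.
  have h1 := key (⨆ x, |D x|) (fun x => le_ciSup hbdd x)
  have h2 := ciSup_le h1
  have h3 := le_ciSup hbdd x
  linarith

theorem exists_abs_cdf_sub_le_of_charFun_unit : ∃ C : ℝ, 0 ≤ C ∧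
    ∀ (μ ν : Measure ℝ) [IsProbabilityMeasure μ] [IsProbabilityMeasure ν] (m : ℝ) (w : ℝ → ℝ),
      0 ≤ m → (∀ x y, x ≤ y → ν.real (Set.Iic y) - ν.real (Set.Iic x) ≤ m * (y - x)) →
      IntervalIntegrable w volume (-1) 1 →
      (∀ t, |t| ≤ 1 → ‖charFun μ t - charFun ν t‖ ≤ |t| * w t) →
      ∀ x, |μ.real (Set.Iic x) - ν.real (Set.Iic x)| ≤ C * ((∫ t in (-1 : ℝ)..1, w t) + m) := by
  obtain ⟨η, hη, hmass⟩ := exists_fejerKernel_mass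
  set c := ∫ u, fejerKernel u with hc
  have hc0 : 0 < c := fejerKernel_integral_pos
  refine ⟨3 * η + 4 / c, by positivity, ?_⟩
  intro μ ν _ _ m w hm hν hw hφ x
  have hFmono : ∀ (ρ : Measure ℝ) [IsProbabilityMeasure ρ], Monotone fun x => ρ.real (Set.Iic x) :=
    fun ρ _ a b hab => measureReal_mono (Set.Iic_subset_Iic.2 hab)
  set D : ℝ → ℝ := fun x => μ.real (Set.Iic x) - ν.real (Set.Iic x) with hDdef
  have hDm : Measurable D := (hFmono μ).measurable.sub (hFmono ν).measurable
  have hD1 : ∀ x, |D x| ≤ 1 := by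
    intro x
    have h1 : μ.real (Set.Iic x) ≤ 1 := measureReal_le_one
    have h2 : ν.real (Set.Iic x) ≤ 1 := measureReal_le_one
    have h3 : 0 ≤ μ.real (Set.Iic x) := measureReal_nonneg
    have h4 : 0 ≤ ν.real (Set.Iic x) := measureReal_nonneg
    exact abs_le.2 ⟨by simp only [hDdef]; linarith, by simp only [hDdef]; linarith⟩
  have hDlim : Tendsto D atBot (𝓝 0) := by
    have h : ∀ (ρ : Measure ℝ) [IsProbabilityMeasure ρ],
        Tendsto (fun x => ρ.real (Set.Iic x)) atBot (𝓝 0) := by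
      intro ρ _
      exact (tendsto_cdf_atBot ρ).congr fun x => cdf_eq_real ρ x
    simpa using (h μ).sub (h ν)
  set E := ∫ t in (-1 : ℝ)..1, w t with hE
  have hIoc : ∀ (ρ : Measure ℝ) [IsProbabilityMeasure ρ] (a b : ℝ), a ≤ b →
      ρ.real (Set.Ioc a b) = ρ.real (Set.Iic b) - ρ.real (Set.Iic a) := by
    intro ρ _ a b hab
    rw [← Set.Iic_sdiff_Iic, measureReal_sdiff (Set.Iic_subset_Iic.2 hab) measurableSet_Iic]
  have hkD : ∀ b, Integrable fun v => fejerKernel v * D (b - v) := by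
    intro b
    refine fejerKernel_integrable.mul_bdd (c := 1) ?_ ?_
    · exact (hDm.comp (by fun_prop)).aestronglyMeasurable
    · filter_upwards with v using hD1 _
  have hdiff : ∀ a b, a ≤ b →
      |(∫ v, fejerKernel v * D (b - v)) - ∫ v, fejerKernel v * D (a - v)| ≤ 2 * E := by
    intro a b hab
    have h := abs_integral_smoothed_sub_le μ ν hw hφ a b
    have hi : ∀ (ρ : Measure ℝ) [IsProbabilityMeasure ρ],
        Integrable fun v => fejerKernel v * ρ.real (Set.Ioc (a - v) (b - v)) := by
      intro ρ _
      refine fejerKernel_integrable.mul_bdd (c := 1) ?_ ?_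
      · have : (fun v => ρ.real (Set.Ioc (a - v) (b - v)))
            = fun v => ρ.real (Set.Iic (b - v)) - ρ.real (Set.Iic (a - v)) := by
          ext v
          exact hIoc ρ _ _ (by linarith)
        rw [this]
        refine Measurable.aestronglyMeasurable (Measurable.sub ?_ ?_)
        · exact (hFmono ρ).measurable.comp (by fun_prop)
        · exact (hFmono ρ).measurable.comp (by fun_prop)
      · filter_upwards with v
        rw [Real.norm_eq_abs, abs_of_nonneg measureReal_nonneg]
        exact measureReal_le_one
    rw [integral_smoothed_eq μ hab, integral_smoothed_eq ν hab, ← integral_sub (hi μ) (hi ν)] at h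
    rw [← integral_sub (hkD b) (hkD a)]
    have heq : (fun v => fejerKernel v * D (b - v) - fejerKernel v * D (a - v))
        = fun v => fejerKernel v * μ.real (Set.Ioc (a - v) (b - v))
          - fejerKernel v * ν.real (Set.Ioc (a - v) (b - v)) := by
      ext v
      rw [hIoc μ _ _ (by linarith), hIoc ν _ _ (by linarith)]
      simp only [hDdef]
      ring
    rw [heq]
    exact h
  have hlim : Tendsto (fun a => ∫ v, fejerKernel v * D (a - v)) atBot (𝓝 0) := by
    have : Tendsto (fun a => ∫ v, fejerKernel v * D (a - v)) atBot
        (𝓝 (∫ v, fejerKernel v * 0)) := by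
      apply tendsto_integral_filter_of_dominated_convergence (bound := fejerKernel)
      · filter_upwards with a using (hkD a).aestronglyMeasurable
      · filter_upwards with a
        filter_upwards with v
        rw [norm_mul, Real.norm_eq_abs, Real.norm_eq_abs, abs_of_nonneg (fejerKernel_nonneg v)]
        exact mul_le_of_le_one_right (fejerKernel_nonneg v) (hD1 _)
      · exact fejerKernel_integrable
      · filter_upwards with v
        exact (hDlim.comp (tendsto_atBot_add_const_right _ (-v) tendsto_id)).const_mul _
    simpa using this
  -- Let `a → -∞` in `hdiff`, where the smoothed difference vanishes.
  have hε : ∀ b, |∫ v, fejerKernel v * D (b - v)| ≤ 2 * E := by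
    intro b
    have h1 : Tendsto (fun a => |(∫ v, fejerKernel v * D (b - v)) - ∫ v, fejerKernel v * D (a - v)|)
        atBot (𝓝 |(∫ v, fejerKernel v * D (b - v)) - 0|) := (hlim.const_sub _).abs
    rw [sub_zero] at h1
    refine le_of_tendsto h1 ?_
    filter_upwards [eventually_le_atBot b] with a ha using hdiff a b ha
  have hE0 : 0 ≤ 2 * E := (abs_nonneg _).trans (hε 0)
  have hfin := abs_le_of_smoothed_le (D := D) (m := m) hm hη hE0 hmass hDm hD1 ?_ hε x
  · refine hfin.trans ?_
    have h1 : 0 ≤ 4 / c * m := by positivity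
    have h2 : 0 ≤ 3 * η * E := by nlinarith
    have h3 : 2 * (2 * E / c) = 4 / c * E := by ring
    rw [h3]
    nlinarith
  · intro a b hab
    have h1 := hν a b hab
    have h2 := hFmono μ hab
    simp only at h2
    simp only [hDdef]
    linarith

/-- **Esseen's smoothing inequality**. -/
theorem exists_abs_cdf_sub_le_of_charFun : ∃ C : ℝ, 0 ≤ C ∧
    ∀ (μ ν : Measure ℝ) [IsProbabilityMeasure μ] [IsProbabilityMeasure ν] (m U : ℝ) (w : ℝ → ℝ),
      0 ≤ m → (∀ x y, x ≤ y → ν.real (Set.Iic y) - ν.real (Set.Iic x) ≤ m * (y - x)) →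
      0 < U → IntervalIntegrable w volume (-U) U →
      (∀ t, |t| ≤ U → ‖charFun μ t - charFun ν t‖ ≤ |t| * w t) →
      ∀ x, |μ.real (Set.Iic x) - ν.real (Set.Iic x)| ≤ C * ((∫ t in (-U)..U, w t) + m / U) := by
  obtain ⟨C, hC, h⟩ := exists_abs_cdf_sub_le_of_charFun_unit
  refine ⟨C, hC, ?_⟩
  intro μ ν _ _ m U w hm hν hU hw hφ x
  have hmeas : Measurable fun y : ℝ => U * y := by fun_prop
  have := Measure.isProbabilityMeasure_map (μ := μ) hmeas.aemeasurable
  have := Measure.isProbabilityMeasure_map (μ := ν) hmeas.aemeasurable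
  have hIic : ∀ (ρ : Measure ℝ) (y : ℝ),
      (ρ.map fun y => U * y).real (Set.Iic y) = ρ.real (Set.Iic (y / U)) := by
    intro ρ y
    rw [map_measureReal_apply hmeas measurableSet_Iic]
    congr 1
    ext z
    simp only [Set.mem_preimage, Set.mem_Iic]
    rw [le_div_iff₀ hU, mul_comm]
  -- Dilating both laws by `U` reduces the band `|t| ≤ U` to `|t| ≤ 1` and the Lipschitz constant
  -- `m` to `m / U`.
  have key := h (μ.map fun y => U * y) (ν.map fun y => U * y) (m / U) (fun t => U * w (U * t))
    (by positivity) ?_ ?_ ?_ (U * x)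
  · rw [hIic, hIic, mul_div_cancel_left₀ x hU.ne', intervalIntegral.integral_const_mul,
      intervalIntegral.integral_comp_mul_left _ hU.ne'] at key
    simpa [hU.ne'] using key
  · intro a b hab
    rw [hIic, hIic]
    refine (hν _ _ (by gcongr)).trans (le_of_eq ?_)
    ring
  · have := (hw.comp_mul_left (c := U)).const_mul U
    simpa [hU.ne', neg_div] using this
  · intro t ht
    rw [charFun_map_mul, charFun_map_mul]
    refine (hφ (U * t) ?_).trans (le_of_eq ?_)
    · rw [abs_mul, abs_of_pos hU]; nlinarith
    · rw [abs_mul, abs_of_pos hU]; ring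

/-! ### From distribution functions to one-sided Laplace integrals. -/

section Tail
variable {μ ν : Measure ℝ} [IsProbabilityMeasure μ] [IsProbabilityMeasure ν] {Δ : ℝ}

theorem tendsto_measureReal_Iic_Iio (μ : Measure ℝ) [IsProbabilityMeasure μ] {x : ℝ} {u : ℕ → ℝ}
    (hu : StrictMono u) (hlt : ∀ n, u n < x) (hx : Tendsto u atTop (𝓝 x)) :
    Tendsto (fun n => μ.real (Set.Iic (u n))) atTop (𝓝 (μ.real (Set.Iio x))) := by
  have h := tendsto_measure_iUnion_atTop (μ := μ) (s := fun n => Set.Iic (u n))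
    (fun a b hab => Set.Iic_subset_Iic.2 (hu.monotone hab))
  rw [iUnion_Iic_eq_Iio_of_lt_of_tendsto hlt hx] at h
  exact (ENNReal.tendsto_toReal (measure_ne_top _ _)).comp h

theorem abs_measureReal_Iio_sub_le (h : ∀ x, |μ.real (Set.Iic x) - ν.real (Set.Iic x)| ≤ Δ)
    (x : ℝ) : |μ.real (Set.Iio x) - ν.real (Set.Iio x)| ≤ Δ := by
  obtain ⟨u, hu, hlt, hx⟩ := exists_seq_strictMono_tendsto x
  exact le_of_tendsto ((tendsto_measureReal_Iic_Iio μ hu hlt hx).sub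
    (tendsto_measureReal_Iic_Iio ν hu hlt hx)).abs (Eventually.of_forall fun n => h (u n))

theorem measureReal_Ici_eq (μ : Measure ℝ) [IsProbabilityMeasure μ] (x : ℝ) :
    μ.real (Set.Ici x) = 1 - μ.real (Set.Iio x) := by
  rw [← probReal_compl_eq_one_sub measurableSet_Iio, Set.compl_Iio]

/-- By the layer-cake formula the integral is an average over levels `t ∈ (0, 1]` of the masses of
superlevel sets. These are empty or intervals starting at 0, and each such mass changes by at most
`2Δ`. -/
theorem abs_setIntegral_exp_neg_sub_le
    (h : ∀ x, |μ.real (Set.Iic x) - ν.real (Set.Iic x)| ≤ Δ) {x : ℝ} (hx : 0 ≤ x) :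
    |(∫ v in Set.Ici 0, Real.exp (-(x * v)) ∂μ) - ∫ v in Set.Ici 0, Real.exp (-(x * v)) ∂ν|
      ≤ 2 * Δ := by
  have h' := abs_measureReal_Iio_sub_le h
  set f : ℝ → ℝ := (Set.Ici 0).indicator fun v => Real.exp (-(x * v)) with hf
  have hf0 : ∀ v, 0 ≤ f v := fun v => Set.indicator_nonneg (fun _ _ => (Real.exp_pos _).le) v
  have hf1 : ∀ v, f v ≤ 1 := by
    intro v
    by_cases hv : v ∈ Set.Ici (0 : ℝ)
    · rw [hf, Set.indicator_of_mem hv, Real.exp_le_one_iff]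
      have : 0 ≤ v := hv
      nlinarith [mul_nonneg hx this]
    · rw [hf, Set.indicator_of_notMem hv]; exact zero_le_one
  have hfm : Measurable f := (by fun_prop : Measurable fun v => Real.exp (-(x * v))).indicator
    measurableSet_Ici
  have hlayer : ∀ (ρ : Measure ℝ) [IsProbabilityMeasure ρ],
      ∫ v in Set.Ici 0, Real.exp (-(x * v)) ∂ρ = ∫ t in Set.Ioc (0 : ℝ) 1, ρ.real {a | t < f a} := by
    intro ρ _
    have hfi : Integrable f ρ := Integrable.of_bound hfm.aestronglyMeasurable 1
      (Eventually.of_forall fun v => by rw [Real.norm_eq_abs, abs_of_nonneg (hf0 v)]; exact hf1 v)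
    rw [← integral_indicator measurableSet_Ici, ← hf,
      hfi.integral_eq_integral_meas_lt (Eventually.of_forall hf0)]
    apply setIntegral_eq_of_subset_of_forall_sdiff_eq_zero measurableSet_Ioi
      Set.Ioc_subset_Ioi_self
    rintro t ⟨ht0, ht1⟩
    have : {a | t < f a} = ∅ := by
      ext a
      simp only [Set.mem_ofPred_eq, Set.mem_empty_iff_false, iff_false, not_lt]
      refine (hf1 a).trans ?_
      by_contra! hlt
      exact ht1 ⟨ht0, hlt.le⟩
    simp [this]
  have hint : ∀ (ρ : Measure ℝ) [IsProbabilityMeasure ρ],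
      IntegrableOn (fun t => ρ.real {a | t < f a}) (Set.Ioc 0 1) := by
    intro ρ _
    have hanti : Antitone fun t => ρ.real {a | t < f a} :=
      fun s t hst => measureReal_mono fun a (ha : t < f a) => hst.trans_lt ha
    refine Integrable.of_bound hanti.measurable.aestronglyMeasurable 1 ?_
    filter_upwards with t
    rw [Real.norm_eq_abs, abs_of_nonneg measureReal_nonneg]
    exact measureReal_le_one
  have hpt : ∀ t ∈ Set.Ioc (0 : ℝ) 1, ‖μ.real {a | t < f a} - ν.real {a | t < f a}‖ ≤ 2 * Δ := by
    intro t ht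
    have hΔ : 0 ≤ Δ := (abs_nonneg _).trans (h 0)
    rcases ht.2.eq_or_lt with rfl | ht1
    · have : {a | 1 < f a} = ∅ := by
        ext a
        simpa using hf1 a
      simp [this, hΔ]
    · rcases hx.eq_or_lt with rfl | hx0
      · have : {a | t < f a} = Set.Ici 0 := by
          ext a
          by_cases ha : a ∈ Set.Ici (0 : ℝ)
          · simp [hf, ha, ht1]
          · simp only [Set.mem_ofPred_eq, hf, Set.indicator_of_notMem ha, ha, iff_false, not_lt]
            exact ht.1.le
        rw [this, measureReal_Ici_eq, measureReal_Ici_eq, Real.norm_eq_abs]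
        have := abs_le.1 (h' 0)
        exact abs_le.2 ⟨by linarith, by linarith⟩
      · set s := -Real.log t / x with hs
        have hs0 : 0 ≤ s := div_nonneg (by linarith [Real.log_neg ht.1 ht1]) hx
        have : {a | t < f a} = Set.Iio s \ Set.Iio 0 := by
          ext a
          by_cases ha : a ∈ Set.Ici (0 : ℝ)
          · have ha' : ¬ a < 0 := not_lt.2 ha
            simp only [Set.mem_ofPred_eq, hf, Set.indicator_of_mem ha, Set.mem_sdiff, Set.mem_Iio, ha',
              not_false_eq_true, and_true]
            rw [← Real.log_lt_iff_lt_exp ht.1, hs, lt_div_iff₀ hx0]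
            constructor <;> intro h <;> linarith
          · have ha' : a < 0 := not_le.1 ha
            simp only [Set.mem_ofPred_eq, hf, Set.indicator_of_notMem ha, Set.mem_sdiff, Set.mem_Iio, ha',
              not_true, and_false, iff_false, not_lt]
            exact ht.1.le
        rw [this, measureReal_sdiff (Set.Iio_subset_Iio hs0) measurableSet_Iio,
          measureReal_sdiff (Set.Iio_subset_Iio hs0) measurableSet_Iio, Real.norm_eq_abs]
        have h1 := abs_le.1 (h' 0)
        have h2 := abs_le.1 (h' s)
        exact abs_le.2 ⟨by linarith, by linarith⟩
  rw [hlayer μ, hlayer ν, ← integral_sub (hint μ) (hint ν)]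
  have := norm_setIntegral_le_of_norm_le_const (μ := volume) (by simp) hpt
  simpa using this

end Tail

/-! ### Exponential tilting. -/

section Tilt
variable {μ : Measure ℝ} [IsProbabilityMeasure μ] {x : ℝ}

/-- The law `μ` tilted by the exponential `y ↦ exp (x y)` and centred at `x`. -/
noncomputable def tiltedShift (μ : Measure ℝ) (x : ℝ) : Measure ℝ :=
  (μ.tilted fun y => x * y).map fun y => y - x

theorem isProbabilityMeasure_tiltedShift (hx : Integrable (fun y => Real.exp (x * y)) μ) :
    IsProbabilityMeasure (tiltedShift μ x) := by
  have := isProbabilityMeasure_tilted hx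
  exact Measure.isProbabilityMeasure_map (by fun_prop)

theorem charFun_tiltedShift (μ : Measure ℝ) (x t : ℝ) : charFun (tiltedShift μ x) t
    = Complex.exp (-(t * x * Complex.I)) * complexMGF id μ (x + t * Complex.I) / mgf id μ x := by
  rw [charFun_apply_real, tiltedShift, integral_map (by fun_prop)
    (by fun_prop : Continuous _).aestronglyMeasurable, integral_tilted, complexMGF,
    ← integral_const_mul, ← integral_div]
  congr 1
  ext y
  rw [mgf, Complex.real_smul]
  push_cast
  rw [div_mul_eq_mul_div, ← Complex.exp_add, ← Complex.exp_add]
  simp only [id]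
  congr 2
  ring

/-- Undo the tilt: with `y = x + v`, the inverse density is `M(x) exp (-x y) = M(x) exp (-x²) exp
(-x v)`, where `M` is the moment generating function. -/
theorem measureReal_Ici_eq_tiltedShift (hx : Integrable (fun y => Real.exp (x * y)) μ) :
    μ.real (Set.Ici x) = mgf id μ x * Real.exp (-x ^ 2)
      * ∫ v in Set.Ici 0, Real.exp (-(x * v)) ∂(tiltedShift μ x) := by
  have hM : 0 < mgf id μ x := mgf_pos hx
  have hpre : (fun y => y - x) ⁻¹' Set.Ici 0 = Set.Ici x := by
    ext y; simp
  rw [tiltedShift, setIntegral_map measurableSet_Ici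
    (by fun_prop : Continuous _).aestronglyMeasurable (by fun_prop), hpre,
    setIntegral_tilted _ _ _, ← integral_const_mul]
  have : ∀ y : ℝ, mgf id μ x * Real.exp (-x ^ 2) *
      ((Real.exp (x * y) / ∫ y, Real.exp (x * y) ∂μ) • Real.exp (-(x * (y - x)))) = 1 := by
    intro y
    have h1 : (∫ y, Real.exp (x * y) ∂μ) = mgf id μ x := rfl
    rw [h1, smul_eq_mul]
    have h2 : Real.exp (-x ^ 2) * Real.exp (x * y) * Real.exp (-(x * (y - x))) = 1 := by
      rw [← Real.exp_add, ← Real.exp_add, Real.exp_eq_one_iff]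
      ring
    field_simp
    linarith [h2]
  simp_rw [this]
  simp

end Tilt

/-! ### The standard normal law under tilting. -/

section Gaussian

theorem complexMGF_id_stdGaussian (z : ℂ) :
    complexMGF id (gaussianReal 0 1) z = Complex.exp (z ^ 2 / 2) := by
  rw [complexMGF_id_gaussianReal]
  simp

theorem mgf_id_stdGaussian (x : ℝ) : mgf id (gaussianReal 0 1) x = Real.exp (x ^ 2 / 2) := by
  have := mgf_gaussianReal (p := gaussianReal 0 1) (X := id) (μ := 0) (v := 1) (by simp) x
  simpa using this

theorem charFun_stdGaussian (t : ℝ) :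
    charFun (gaussianReal 0 1) t = Complex.exp (-(t : ℂ) ^ 2 / 2) := by
  rw [charFun_gaussianReal]
  simp [neg_div]

theorem tiltedShift_stdGaussian (x : ℝ) :
    tiltedShift (gaussianReal 0 1) x = gaussianReal 0 1 := by
  have := isProbabilityMeasure_tiltedShift (integrable_exp_mul_gaussianReal (μ := 0) (v := 1) x)
  apply Measure.ext_of_charFun
  ext t
  rw [charFun_tiltedShift, charFun_stdGaussian, complexMGF_id_stdGaussian, mgf_id_stdGaussian,
    Complex.ofReal_exp, ← Complex.exp_add, ← Complex.exp_sub]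
  congr 1
  push_cast
  ring_nf
  simp
  ring

theorem stdGaussian_Ici_eq (x : ℝ) : (gaussianReal 0 1).real (Set.Ici x)
    = Real.exp (-x ^ 2 / 2) * ∫ v in Set.Ici 0, Real.exp (-(x * v)) ∂(gaussianReal 0 1) := by
  rw [measureReal_Ici_eq_tiltedShift (integrable_exp_mul_gaussianReal (μ := 0) (v := 1) x),
    tiltedShift_stdGaussian, mgf_id_stdGaussian, ← Real.exp_add]
  congr 2
  ring

theorem gaussianPDFReal_std_le (x : ℝ) : gaussianPDFReal 0 1 x ≤ 1 := by
  rw [gaussianPDFReal]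
  have h1 : (√(2 * Real.pi * ((1 : NNReal) : ℝ)))⁻¹ ≤ 1 := by
    apply inv_le_one_of_one_le₀
    rw [Real.one_le_sqrt]
    have := Real.pi_gt_three
    simp
    linarith
  have h2 : Real.exp (-(x - 0) ^ 2 / (2 * ((1 : NNReal) : ℝ))) ≤ 1 := by
    rw [Real.exp_le_one_iff]
    simp
    nlinarith [sq_nonneg x]
  exact mul_le_one₀ h1 (Real.exp_pos _).le h2

theorem stdGaussian_Iic_sub_le {x y : ℝ} (hxy : x ≤ y) :
    (gaussianReal 0 1).real (Set.Iic y) - (gaussianReal 0 1).real (Set.Iic x) ≤ 1 * (y - x) := by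
  have hsub : Set.Iic y \ Set.Iic x = Set.Ioc x y := by
    ext z; simp [and_comm]
  rw [← measureReal_sdiff (Set.Iic_subset_Iic.2 hxy) measurableSet_Iic, hsub, measureReal_def,
    gaussianReal_apply_eq_integral _ one_ne_zero, ENNReal.toReal_ofReal
      (setIntegral_nonneg measurableSet_Ioc fun z _ => gaussianPDFReal_nonneg _ _ _)]
  have := setIntegral_mono_on (μ := volume) (s := Set.Ioc x y) (f := gaussianPDFReal 0 1)
    (g := fun _ => 1)
    (integrable_gaussianPDFReal 0 1).integrableOn (by simp) measurableSet_Ioc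
    (fun z _ => gaussianPDFReal_std_le z)
  refine this.trans (le_of_eq ?_)
  simp [hxy]

/-- The Gaussian density is at most 1. This bound later absorbs the factor `x` in `|exp (r x) - 1| =
O(x/T)`. -/
theorem mul_setIntegral_exp_neg_stdGaussian_le {x : ℝ} (hx : 0 ≤ x) :
    x * ∫ v in Set.Ici 0, Real.exp (-(x * v)) ∂(gaussianReal 0 1) ≤ 1 := by
  rcases hx.eq_or_lt with rfl | hx0
  · simp
  have hie : IntegrableOn (fun v => Real.exp (-(x * v))) (Set.Ioi 0) := by
    simpa [neg_mul] using integrableOn_exp_mul_Ioi (a := -x) (by linarith) 0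
  have h1 : ∫ v in Set.Ici 0, Real.exp (-(x * v)) ∂(gaussianReal 0 1) ≤ 1 / x := by
    rw [← integral_indicator measurableSet_Ici, integral_gaussianReal_eq_integral_smul one_ne_zero]
    have heq : (fun v => gaussianPDFReal 0 1 v •
        (Set.Ici 0).indicator (fun v => Real.exp (-(x * v))) v)
        = (Set.Ici 0).indicator (fun v => gaussianPDFReal 0 1 v * Real.exp (-(x * v))) := by
      ext v
      by_cases hv : v ∈ Set.Ici (0 : ℝ)
      · simp only [Set.indicator_of_mem hv, smul_eq_mul]
      · simp only [Set.indicator_of_notMem hv, smul_zero]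
    rw [heq, integral_indicator measurableSet_Ici, integral_Ici_eq_integral_Ioi]
    have hle : ∫ v in Set.Ioi 0, gaussianPDFReal 0 1 v * Real.exp (-(x * v))
        ≤ ∫ v in Set.Ioi 0, Real.exp (-(x * v)) := by
      apply integral_mono_of_nonneg
      · exact Eventually.of_forall fun v =>
          mul_nonneg (gaussianPDFReal_nonneg _ _ _) (Real.exp_pos _).le
      · exact hie
      · exact Eventually.of_forall fun v =>
          mul_le_of_le_one_left (Real.exp_pos _).le (gaussianPDFReal_std_le v)
    refine hle.trans (le_of_eq ?_)
    have := integral_exp_mul_Ioi (a := -x) (by linarith) 0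
    simpa [neg_mul, one_div] using this
  calc _ ≤ x * (1 / x) := by gcongr
    _ = 1 := by field_simp

end Gaussian

/-! ### Cauchy estimates for the remainder. -/

theorem norm_le_of_norm_deriv_le_pow {f : ℂ → ℂ} {R c : ℝ} {k : ℕ} (hc : 0 ≤ c)
    (hf : DifferentiableOn ℂ f (Metric.ball 0 R)) (h0 : f 0 = 0)
    (h : ∀ z ∈ Metric.ball (0 : ℂ) R, ‖deriv f z‖ ≤ c * ‖z‖ ^ k) :
    ∀ z ∈ Metric.ball (0 : ℂ) R, ‖f z‖ ≤ c * ‖z‖ ^ (k + 1) := by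
  intro z hz
  have hz' : ‖z‖ < R := by simpa using hz
  have hsub : Metric.closedBall (0 : ℂ) ‖z‖ ⊆ Metric.ball 0 R := Metric.closedBall_subset_ball hz'
  have := (convex_closedBall (0 : ℂ) ‖z‖).norm_image_sub_le_of_norm_deriv_le (f := f)
    (C := c * ‖z‖ ^ k) (x := 0) (y := z)
    (fun w hw => hf.differentiableAt (Metric.isOpen_ball.mem_nhds (hsub hw)))
    (fun w hw => (h w (hsub hw)).trans (by
      have : ‖w‖ ≤ ‖z‖ := by simpa using hw
      gcongr)) (by simp) (by simp)
  simpa [h0, pow_succ, mul_assoc] using this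

/-- A bounded analytic function vanishing to fourth order at the centre of a disc. -/
theorem norm_le_of_iteratedDeriv_eq_zero {r : ℂ → ℂ} {R B : ℝ} (hR : 0 < R)
    (hr : DifferentiableOn ℂ r (Metric.ball 0 R)) (hB : ∀ z ∈ Metric.ball (0 : ℂ) R, ‖r z‖ ≤ B)
    (h0 : ∀ k < 4, iteratedDeriv k r 0 = 0) :
    ∀ z ∈ Metric.ball (0 : ℂ) (R / 2),
      ‖deriv r z‖ ≤ 6144 * B / R ^ 4 * ‖z‖ ^ 3 ∧ ‖r z‖ ≤ 6144 * B / R ^ 4 * ‖z‖ ^ 4 := by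
  have hB0 : 0 ≤ B := (norm_nonneg _).trans (hB 0 (by simpa))
  set c := 6144 * B / R ^ 4 with hc
  have hc0 : 0 ≤ c := by positivity
  have hsub : Metric.ball (0 : ℂ) (R / 2) ⊆ Metric.ball 0 R := Metric.ball_subset_ball (by linarith)
  have hd : ∀ k, DifferentiableOn ℂ (iteratedDeriv k r) (Metric.ball 0 R) := by
    intro k
    induction k with
    | zero => simpa using hr
    | succ k ih => rw [iteratedDeriv_succ]; exact ih.deriv Metric.isOpen_ball
  -- Cauchy's estimate on circles of radius `R/4`; the constant is `6144 = 4! * 4 ^ 4`.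
  have h4 : ∀ z ∈ Metric.ball (0 : ℂ) (R / 2), ‖iteratedDeriv 4 r z‖ ≤ c * ‖z‖ ^ 0 := by
    intro z hz
    have hzR : ‖z‖ < R / 2 := by simpa using hz
    have hcl : Metric.closedBall z (R / 4) ⊆ Metric.ball 0 R := by
      intro w hw
      have h1 : ‖w - z‖ ≤ R / 4 := by simpa [dist_eq_norm] using hw
      have h2 := norm_le_norm_add_norm_sub' w z
      simp only [mem_ball_zero_iff]
      linarith
    have := Complex.norm_iteratedDeriv_le_of_forall_mem_sphere_norm_le (c := z) (R := R / 4) (C := B)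
      (f := r) 4 (by positivity) ((hr.mono hcl).diffContOnCl_ball subset_rfl)
      (fun w hw => hB w (hcl (Metric.sphere_subset_closedBall hw)))
    refine this.trans (le_of_eq ?_)
    rw [hc]
    norm_num [Nat.factorial]
    field_simp
    ring
  -- Each lower derivative vanishes at 0, so the mean value inequality gains one power of `‖z‖` per
  -- step, without changing the constant.
  have step : ∀ k j, k < 4 →
      (∀ z ∈ Metric.ball (0 : ℂ) (R / 2), ‖iteratedDeriv (k + 1) r z‖ ≤ c * ‖z‖ ^ j) →
      ∀ z ∈ Metric.ball (0 : ℂ) (R / 2), ‖iteratedDeriv k r z‖ ≤ c * ‖z‖ ^ (j + 1) := by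
    intro k j hk h
    apply norm_le_of_norm_deriv_le_pow hc0 ((hd k).mono hsub) (h0 k hk)
    intro z hz
    rw [← iteratedDeriv_succ]
    exact h z hz
  have h3 := step 3 0 (by norm_num) h4
  have h2 := step 2 1 (by norm_num) h3
  have h1 := step 1 2 (by norm_num) h2
  have h0 := step 0 3 (by norm_num) h1
  intro z hz
  exact ⟨by simpa using h1 z hz, by simpa using h0 z hz⟩

theorem norm_exp_sub_one_le_mul_exp (z : ℂ) : ‖Complex.exp z - 1‖ ≤ ‖z‖ * Real.exp ‖z‖ := by
  simpa using Complex.norm_exp_sub_sum_le_norm_mul_exp z 1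

theorem integrable_add_sq_mul_exp (κ : ℝ) :
    Integrable fun t : ℝ => (κ + t ^ 2) * Real.exp (-t ^ 2 / 4) := by
  have h1 := (integrable_exp_neg_mul_sq (b := 1 / 4) (by norm_num)).const_mul κ
  have h2 := integrable_rpow_mul_exp_neg_mul_sq (b := 1 / 4) (by norm_num) (s := 2) (by norm_num)
  refine (h1.add h2).congr (Eventually.of_forall fun t => ?_)
  simp only [Pi.add_apply, Real.rpow_two]
  rw [show -(1 / 4) * t ^ 2 = -t ^ 2 / 4 by ring]
  ring

/-! ### The characteristic function of the tilted law. -/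

section Core
variable {μ : Measure ℝ} {r : ℂ → ℂ} {T M κ x : ℝ}

/-- A non-integrable exponential would have integral 0 by convention, which no exponential equals.
-/
theorem integrable_exp_mul_of_complexMGF_eq_exp {w : ℂ} (h : complexMGF id μ x = Complex.exp w) :
    Integrable (fun y => Real.exp (x * y)) μ := by
  by_contra hcon
  have h1 : mgf id μ x = 0 := integral_undef hcon
  rw [complexMGF_ofReal, h1] at h
  exact Complex.exp_ne_zero w (by simpa using h.symm)

theorem mgf_eq_exp_of_complexMGF_eq_exp {w : ℂ} (h : complexMGF id μ x = Complex.exp w) :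
    mgf id μ x = Real.exp w.re := by
  rw [complexMGF_ofReal] at h
  rw [← Complex.norm_exp, ← h, Complex.norm_real, Real.norm_eq_abs, abs_of_nonneg mgf_nonneg]

theorem charFun_tiltedShift_eq_exp {t : ℝ}
    (h0 : complexMGF id μ x = Complex.exp ((x : ℂ) ^ 2 / 2 + r x))
    (ht : complexMGF id μ (x + t * Complex.I)
      = Complex.exp ((x + t * Complex.I) ^ 2 / 2 + r (x + t * Complex.I))) :
    charFun (tiltedShift μ x) t
      = Complex.exp (-(t : ℂ) ^ 2 / 2) * Complex.exp (r (x + t * Complex.I) - r x) := by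
  rw [charFun_tiltedShift, ← complexMGF_ofReal, h0, ht, ← Complex.exp_add, ← Complex.exp_sub,
    ← Complex.exp_add]
  congr 1
  have := Complex.I_sq
  linear_combination (t : ℂ) ^ 2 / 2 * this

theorem norm_sub_le_of_norm_deriv_le_cube (hT : 0 < T) (hM : 0 ≤ M)
    (hr : DifferentiableOn ℂ r (Metric.ball 0 (T / 2)))
    (hd : ∀ z ∈ Metric.ball (0 : ℂ) (T / 2), ‖deriv r z‖ ≤ M / T ^ 2 * ‖z‖ ^ 3)
    (hx : 0 ≤ x) (hxT : x ≤ T / 8) (hxκ : x ^ 3 ≤ κ * T) {t : ℝ} (ht : |t| ≤ T / 4) :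
    ‖r (x + t * Complex.I) - r x‖ ≤ |t| * (4 * M / T ^ 2 * (κ * T + |t| ^ 3)) := by
  have hlt : x + |t| < T / 2 := by linarith
  have hsub : Metric.closedBall (0 : ℂ) (x + |t|) ⊆ Metric.ball 0 (T / 2) :=
    Metric.closedBall_subset_ball hlt
  have hnx : ‖(x : ℂ)‖ = x := by simp [abs_of_nonneg hx]
  have hnt : ‖(t : ℂ) * Complex.I‖ = |t| := by simp
  have ht0 := abs_nonneg t
  have h := (convex_closedBall (0 : ℂ) (x + |t|)).norm_image_sub_le_of_norm_deriv_le (f := r)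
    (C := 4 * M / T ^ 2 * (κ * T + |t| ^ 3)) (x := x) (y := x + t * Complex.I)
    (fun w hw => hr.differentiableAt (Metric.isOpen_ball.mem_nhds (hsub hw)))
    (fun w hw => (hd w (hsub hw)).trans ?_) ?_ ?_
  · rw [add_sub_cancel_left, hnt] at h
    linarith
  · have hw' : ‖w‖ ≤ x + |t| := by simpa using hw
    have h1 : ‖w‖ ^ 3 ≤ (x + |t|) ^ 3 := by gcongr
    have h2 : (x + |t|) ^ 3 ≤ 4 * (x ^ 3 + |t| ^ 3) := by
      nlinarith [mul_nonneg (add_nonneg hx ht0) (sq_nonneg (x - |t|))]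
    calc M / T ^ 2 * ‖w‖ ^ 3 ≤ M / T ^ 2 * (4 * (κ * T + |t| ^ 3)) := by
          gcongr
          linarith
      _ = 4 * M / T ^ 2 * (κ * T + |t| ^ 3) := by ring
  · simp [abs_of_nonneg hx]
  · rw [mem_closedBall_zero_iff]
    refine (norm_add_le _ _).trans ?_
    rw [hnx, hnt]

/-- The exponent `ρ = r (x + it) - r x` is bounded twice. The bound `hρ1` carries the factor
`|t|/T`; the bound `hρ2`, valid for `|t| ≤ δT`, lets `exp ‖ρ‖` consume only half of the Gaussian
decay `exp (-t²/2)`. -/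
theorem norm_charFun_tiltedShift_sub_le (hT : 0 < T) (hM : 0 ≤ M)
    (hr : DifferentiableOn ℂ r (Metric.ball 0 (T / 2)))
    (hd : ∀ z ∈ Metric.ball (0 : ℂ) (T / 2), ‖deriv r z‖ ≤ M / T ^ 2 * ‖z‖ ^ 3)
    (hμ : ∀ z ∈ Metric.ball (0 : ℂ) (T / 2), complexMGF id μ z = Complex.exp (z ^ 2 / 2 + r z))
    (hx : 0 ≤ x) (hxT : x ≤ T / 8) (hxκ : x ^ 3 ≤ κ * T) (hκ : 0 ≤ κ) {δ : ℝ} (hδ0 : 0 < δ)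
    (hδ : δ ≤ 1 / 4) (hMδ : 16 * M * δ ^ 2 ≤ 1) {t : ℝ} (ht : |t| ≤ δ * T) :
    ‖charFun (tiltedShift μ x) t - charFun (gaussianReal 0 1) t‖
      ≤ |t| * (4 * M * Real.exp (4 * M * κ) / T * ((κ + t ^ 2) * Real.exp (-t ^ 2 / 4))) := by
  have ht4 : |t| ≤ T / 4 := by nlinarith
  have ht0 := abs_nonneg t
  have hx0 : (x : ℂ) ∈ Metric.ball (0 : ℂ) (T / 2) := by
    simp [abs_of_nonneg hx]; linarith
  have hxt : (x + t * Complex.I : ℂ) ∈ Metric.ball (0 : ℂ) (T / 2) := by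
    rw [mem_ball_zero_iff]
    refine (norm_add_le _ _).trans_lt ?_
    simp [abs_of_nonneg hx]; linarith
  rw [charFun_tiltedShift_eq_exp (hμ _ hx0) (hμ _ hxt), charFun_stdGaussian, ← mul_sub_one, norm_mul]
  set ρ := r (x + t * Complex.I) - r x with hρ
  have h1 := norm_sub_le_of_norm_deriv_le_cube hT hM hr hd hx hxT hxκ ht4
  have hgauss : ‖Complex.exp (-(t : ℂ) ^ 2 / 2)‖ = Real.exp (-t ^ 2 / 2) := by
    rw [show (-(t : ℂ) ^ 2 / 2) = ((-t ^ 2 / 2 : ℝ) : ℂ) by push_cast; ring, ← Complex.ofReal_exp,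
      Complex.norm_real, Real.norm_eq_abs, abs_of_pos (Real.exp_pos _)]
  have hsq : |t| ^ 2 = t ^ 2 := sq_abs t
  have hcube : |t| ^ 3 ≤ t ^ 2 * T := by
    rw [pow_succ, hsq]
    have : |t| ≤ T := by linarith
    gcongr
  have hρ1 : ‖ρ‖ ≤ |t| * (4 * M / T * (κ + t ^ 2)) := by
    refine h1.trans ?_
    have : 4 * M / T ^ 2 * (κ * T + |t| ^ 3) ≤ 4 * M / T ^ 2 * (κ * T + t ^ 2 * T) := by gcongr
    have h2 : 4 * M / T ^ 2 * (κ * T + t ^ 2 * T) = 4 * M / T * (κ + t ^ 2) := by field_simp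
    rw [h2] at this
    gcongr
  have hρ2 : ‖ρ‖ ≤ 4 * M * κ + t ^ 2 / 4 := by
    refine h1.trans ?_
    have e1 : |t| * (4 * M / T ^ 2 * (κ * T + |t| ^ 3))
        = 4 * M * κ * (|t| / T) + 4 * M * t ^ 2 * (|t| / T) ^ 2 := by
      rw [← hsq]; field_simp
    have e2 : |t| / T ≤ δ := by rwa [div_le_iff₀ hT]
    have e3 : 0 ≤ |t| / T := by positivity
    have e4 : 4 * M * κ * (|t| / T) ≤ 4 * M * κ * 1 := by
      gcongr
      linarith
    have e5 : 4 * M * t ^ 2 * (|t| / T) ^ 2 ≤ 4 * M * t ^ 2 * δ ^ 2 := by gcongr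
    have e6 : 4 * M * t ^ 2 * δ ^ 2 ≤ t ^ 2 / 4 := by nlinarith [sq_nonneg t]
    linarith
  rw [hgauss]
  calc Real.exp (-t ^ 2 / 2) * ‖Complex.exp ρ - 1‖
      ≤ Real.exp (-t ^ 2 / 2) * (|t| * (4 * M / T * (κ + t ^ 2))
          * Real.exp (4 * M * κ + t ^ 2 / 4)) := by
        gcongr
        refine (norm_exp_sub_one_le_mul_exp ρ).trans ?_
        gcongr
    _ = |t| * (4 * M / T * (κ + t ^ 2)) * (Real.exp (-t ^ 2 / 2)
          * Real.exp (4 * M * κ + t ^ 2 / 4)) := by ring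
    _ = |t| * (4 * M / T * (κ + t ^ 2)) * (Real.exp (4 * M * κ) * Real.exp (-t ^ 2 / 4)) := by
        rw [← Real.exp_add, ← Real.exp_add]
        congr 2
        ring
    _ = _ := by ring

end Core

/-! ### The large deviation estimate for a single law. -/

theorem exists_abs_cdf_tiltedShift_sub_le (M κ : ℝ) (hM : 0 ≤ M) (hκ : 0 ≤ κ) :
    ∃ C : ℝ, 0 ≤ C ∧ ∀ (μ : Measure ℝ) [IsProbabilityMeasure μ] (r : ℂ → ℂ) (T x : ℝ), 0 < T →
      DifferentiableOn ℂ r (Metric.ball 0 (T / 2)) →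
      (∀ z ∈ Metric.ball (0 : ℂ) (T / 2), ‖deriv r z‖ ≤ M / T ^ 2 * ‖z‖ ^ 3) →
      (∀ z ∈ Metric.ball (0 : ℂ) (T / 2), complexMGF id μ z = Complex.exp (z ^ 2 / 2 + r z)) →
      0 ≤ x → x ≤ T / 8 → x ^ 3 ≤ κ * T → ∀ y,
      |(tiltedShift μ x).real (Set.Iic y) - (gaussianReal 0 1).real (Set.Iic y)| ≤ C / T := by
  obtain ⟨C, hC, hE⟩ := exists_abs_cdf_sub_le_of_charFun
  have hI := integrable_add_sq_mul_exp κ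
  have hnn : ∀ t : ℝ, 0 ≤ (κ + t ^ 2) * Real.exp (-t ^ 2 / 4) := fun t => by positivity
  set I := ∫ t : ℝ, (κ + t ^ 2) * Real.exp (-t ^ 2 / 4) with hIdef
  have hI0 : 0 ≤ I := integral_nonneg hnn
  -- Small enough that both `δ ≤ 1/4` and `16 M δ² = M/(1 + M)² ≤ 1`.
  set δ := 1 / (4 * (1 + M)) with hδ
  have hδ0 : 0 < δ := by positivity
  have hδ4 : δ ≤ 1 / 4 := by
    rw [hδ, div_le_div_iff₀ (by positivity) (by norm_num)]
    linarith
  have hMδ : 16 * M * δ ^ 2 ≤ 1 := by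
    rw [hδ, div_pow, ← mul_div_assoc, div_le_one (by positivity)]
    nlinarith
  refine ⟨C * (4 * M * Real.exp (4 * M * κ) * I + 1 / δ), by positivity, ?_⟩
  intro μ _ r T x hT hr hd hμ hx hxT hxκ y
  have hx0 : (x : ℂ) ∈ Metric.ball (0 : ℂ) (T / 2) := by
    simp [abs_of_nonneg hx]; linarith
  have := isProbabilityMeasure_tiltedShift (integrable_exp_mul_of_complexMGF_eq_exp (hμ _ hx0))
  have hint : Integrable fun t : ℝ => 4 * M * Real.exp (4 * M * κ) / T
      * ((κ + t ^ 2) * Real.exp (-t ^ 2 / 4)) := hI.const_mul _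
  have key := hE (tiltedShift μ x) (gaussianReal 0 1) 1 (δ * T)
    (fun t => 4 * M * Real.exp (4 * M * κ) / T * ((κ + t ^ 2) * Real.exp (-t ^ 2 / 4)))
    zero_le_one (fun a b hab => stdGaussian_Iic_sub_le hab) (by positivity)
    hint.intervalIntegrable
    (fun t ht => norm_charFun_tiltedShift_sub_le hT hM hr hd hμ hx hxT hxκ hκ hδ0 hδ4 hMδ ht) y
  refine key.trans ?_
  have hle : (∫ t in (-(δ * T))..(δ * T), 4 * M * Real.exp (4 * M * κ) / T
      * ((κ + t ^ 2) * Real.exp (-t ^ 2 / 4))) ≤ 4 * M * Real.exp (4 * M * κ) / T * I := by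
    have hδT : 0 < δ * T := by positivity
    rw [intervalIntegral.integral_const_mul, intervalIntegral.integral_of_le (by linarith)]
    gcongr
    exact setIntegral_le_integral hI (Eventually.of_forall hnn)
  calc _ ≤ C * (4 * M * Real.exp (4 * M * κ) / T * I + 1 / (δ * T)) := by gcongr
    _ = _ := by field_simp

theorem stdNormalCDF_eq (x : ℝ) : stdNormalCDF x = 1 - (gaussianReal 0 1).real (Set.Ici x) := by
  have := nullSingletonClass_gaussianReal (μ := 0) (v := 1) one_ne_zero
  rw [stdNormalCDF, cdf_eq_real, measureReal_Ici_eq, sub_sub_cancel, measureReal_def, measureReal_def,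
    measure_congr Iio_ae_eq_Iic]

/-- Large deviations for a single law whose cumulant generating function is analytic and of size
`O(T ^ 2)` on the disc of radius `T`, and agrees with the Gaussian one up to third order. -/
theorem exists_abs_measureReal_Iio_sub_stdNormalCDF_le (A κ : ℝ) (hA : 0 ≤ A) (hκ : 0 ≤ κ) :
    ∃ C : ℝ, 0 ≤ C ∧ ∀ (μ : Measure ℝ) [IsProbabilityMeasure μ] (r : ℂ → ℂ) (T x : ℝ), 0 < T →
      512 * κ ≤ T ^ 2 →
      DifferentiableOn ℂ r (Metric.ball 0 T) →
      (∀ z ∈ Metric.ball (0 : ℂ) T, ‖r z‖ ≤ A * T ^ 2) →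
      (∀ k < 4, iteratedDeriv k r 0 = 0) →
      (∀ z ∈ Metric.ball (0 : ℂ) T, complexMGF id μ z = Complex.exp (z ^ 2 / 2 + r z)) →
      0 ≤ x → x ^ 3 ≤ κ * T →
      |μ.real (Set.Iio x) - stdNormalCDF x| ≤ C * (Real.exp (-x ^ 2 / 2) / T) := by
  set M := 6144 * A with hMdef
  have hM : 0 ≤ M := by positivity
  obtain ⟨C, hC, hQ⟩ := exists_abs_cdf_tiltedShift_sub_le M κ hM hκ
  refine ⟨M * κ * Real.exp (M * κ) + Real.exp (M * κ) * (2 * C), by positivity, ?_⟩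
  intro μ _ r T x hT hκT hr hrA hr0 hμ hx hxκ
  have hsub : Metric.ball (0 : ℂ) (T / 2) ⊆ Metric.ball 0 T := Metric.ball_subset_ball (by linarith)
  have hbd := norm_le_of_iteratedDeriv_eq_zero hT hr hrA hr0
  have hMT : 6144 * (A * T ^ 2) / T ^ 4 = M / T ^ 2 := by rw [hMdef]; field_simp
  rw [hMT] at hbd
  -- Otherwise `x³ > T³/512 ≥ κT`.
  have hxT : x ≤ T / 8 := by
    by_contra! hlt
    have : (T / 8) ^ 3 < x ^ 3 := by gcongr
    nlinarith
  have hx0 : (x : ℂ) ∈ Metric.ball (0 : ℂ) (T / 2) := by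
    simp [abs_of_nonneg hx]; linarith
  have hQ' := hQ μ r T x hT (hr.mono hsub) (fun z hz => (hbd z hz).1) (fun z hz => hμ z (hsub hz))
    hx hxT hxκ
  have hint := integrable_exp_mul_of_complexMGF_eq_exp (hμ _ (hsub hx0))
  have := isProbabilityMeasure_tiltedShift hint
  have hJJ := abs_setIntegral_exp_neg_sub_le hQ' hx
  set JQ := ∫ v in Set.Ici 0, Real.exp (-(x * v)) ∂(tiltedShift μ x) with hJQ
  set J := ∫ v in Set.Ici 0, Real.exp (-(x * v)) ∂(gaussianReal 0 1) with hJ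
  have hJ1 : x * J ≤ 1 := mul_setIntegral_exp_neg_stdGaussian_le hx
  have hJ0 : 0 ≤ J := setIntegral_nonneg measurableSet_Ici fun v _ => (Real.exp_pos _).le
  set ρ := (r x).re with hρ
  have hmgf : mgf id μ x = Real.exp (x ^ 2 / 2 + ρ) := by
    rw [mgf_eq_exp_of_complexMGF_eq_exp (hμ _ (hsub hx0)), Complex.add_re, ← hρ]
    congr 2
    rw [show (x : ℂ) ^ 2 / 2 = ((x ^ 2 / 2 : ℝ) : ℂ) by push_cast; ring, Complex.ofReal_re]
  have hμIci : μ.real (Set.Ici x) = Real.exp (-x ^ 2 / 2) * (Real.exp ρ * JQ) := by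
    rw [measureReal_Ici_eq_tiltedShift hint, ← hJQ, hmgf, ← Real.exp_add, ← mul_assoc,
      ← Real.exp_add]
    congr 2
    ring
  -- The fourth-order bound splits as `x⁴ = x * x³` with `x³ ≤ κT`; the remaining `x` is kept to be
  -- cancelled against `J`.
  have hρ1 : |ρ| ≤ M * κ * (x / T) := by
    have h1 : |ρ| ≤ M / T ^ 2 * x ^ 4 := by
      refine (Complex.abs_re_le_norm _).trans ?_
      simpa [abs_of_nonneg hx] using (hbd _ hx0).2
    calc |ρ| ≤ M / T ^ 2 * x ^ 4 := h1
      _ = M / T ^ 2 * x * x ^ 3 := by ring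
      _ ≤ M / T ^ 2 * x * (κ * T) := by gcongr
      _ = _ := by field_simp
  have hρ2 : |ρ| ≤ M * κ := by
    refine hρ1.trans ?_
    have : x / T ≤ 1 := by rw [div_le_one hT]; linarith
    nlinarith [mul_nonneg hM hκ]
  have hexp : |Real.exp ρ - 1| ≤ M * κ * (x / T) * Real.exp (M * κ) := by
    have h1 := norm_exp_sub_one_le_mul_exp (ρ : ℂ)
    rw [← Complex.ofReal_exp, ← Complex.ofReal_one, ← Complex.ofReal_sub, Complex.norm_real,
      Complex.norm_real, Real.norm_eq_abs, Real.norm_eq_abs] at h1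
    refine h1.trans ?_
    gcongr
  have hexp2 : Real.exp ρ ≤ Real.exp (M * κ) := Real.exp_le_exp.2 ((le_abs_self _).trans hρ2)
  have hmain : |J - Real.exp ρ * JQ|
      ≤ (M * κ * Real.exp (M * κ) + Real.exp (M * κ) * (2 * C)) / T := by
    have e1 : J - Real.exp ρ * JQ = -((Real.exp ρ - 1) * J) - Real.exp ρ * (JQ - J) := by ring
    rw [e1]
    refine (abs_sub _ _).trans ?_
    rw [abs_neg, abs_mul, abs_mul, abs_of_nonneg hJ0, abs_of_pos (Real.exp_pos ρ)]
    have e2 : |Real.exp ρ - 1| * J ≤ M * κ * (x / T) * Real.exp (M * κ) * J := by gcongr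
    have e3 : M * κ * (x / T) * Real.exp (M * κ) * J ≤ M * κ * Real.exp (M * κ) / T := by
      have : M * κ * (x / T) * Real.exp (M * κ) * J
          = M * κ * Real.exp (M * κ) / T * (x * J) := by ring
      rw [this]
      exact mul_le_of_le_one_right (by positivity) hJ1
    have e4 : Real.exp ρ * |JQ - J| ≤ Real.exp (M * κ) * (2 * (C / T)) := by gcongr
    calc _ ≤ M * κ * Real.exp (M * κ) / T + Real.exp (M * κ) * (2 * (C / T)) := by linarith
      _ = _ := by ring
  -- Both tails carry the same prefactor `exp (-x²/2)`, so only the bracket has to be `O(1/T)`.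
  have hsplit : μ.real (Set.Iio x) - stdNormalCDF x
      = Real.exp (-x ^ 2 / 2) * (J - Real.exp ρ * JQ) := by
    have h1 := measureReal_Ici_eq μ x
    rw [stdNormalCDF_eq, stdGaussian_Ici_eq, ← hJ]
    rw [hμIci] at h1
    linarith
  rw [hsplit, abs_mul, abs_of_pos (Real.exp_pos _)]
  calc _ ≤ Real.exp (-x ^ 2 / 2)
        * ((M * κ * Real.exp (M * κ) + Real.exp (M * κ) * (2 * C)) / T) := by gcongr
    _ = _ := by ring

/-! ### Lattice sums, and derivatives of series of analytic functions. -/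

theorem tendsto_latticeCube (d : ℕ) : Tendsto (latticeCube d) atTop atTop := by
  apply tendsto_atTop_finset_of_monotone
  · intro m m' h
    apply Finset.Icc_subset_Icc <;> intro i <;> simp [h]
  · intro j
    refine ⟨∑ i, (j i).natAbs, ?_⟩
    have h : ∀ i, |j i| ≤ ((∑ i, (j i).natAbs : ℕ) : ℤ) := by
      intro i
      rw [Int.abs_eq_natAbs]
      exact_mod_cast Finset.single_le_sum (f := fun i => (j i).natAbs) (fun _ _ => Nat.zero_le _)
        (Finset.mem_univ i)
    simp only [latticeCube, Finset.mem_Icc]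
    exact ⟨fun i => (abs_le.1 (h i)).1, fun i => (abs_le.1 (h i)).2⟩

section Derivatives

/-- Induct on `k`, passing to the derivatives on the disc of half the radius; Cauchy's estimate
keeps a summable majorant `u i / (R / 4)`. -/
theorem hasSum_iteratedDeriv_zero {ι : Type*} (k : ℕ) :
    ∀ {f : ι → ℂ → ℂ} {u : ι → ℝ} {R : ℝ}, 0 < R → Summable u →
      (∀ i, DifferentiableOn ℂ (f i) (Metric.ball 0 R)) →
      (∀ i, ∀ z ∈ Metric.ball (0 : ℂ) R, ‖f i z‖ ≤ u i) →
      HasSum (fun i => iteratedDeriv k (f i) 0) (iteratedDeriv k (fun z => ∑' i, f i z) 0) := by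
  induction k with
  | zero =>
    intro f u R hR hu hf hb
    simp only [iteratedDeriv_zero]
    exact (Summable.of_norm_bounded hu fun i => hb i 0 (by simpa)).hasSum
  | succ k ih =>
    intro f u R hR hu hf hb
    have hsub : Metric.ball (0 : ℂ) (R / 2) ⊆ Metric.ball 0 R := Metric.ball_subset_ball (by linarith)
    have h := ih (f := fun i => deriv (f i)) (u := fun i => u i / (R / 4)) (R := R / 2)
      (by positivity) (hu.div_const _)
      (fun i => ((hf i).deriv Metric.isOpen_ball).mono hsub) ?_
    · simp_rw [iteratedDeriv_succ']
      have heq : (fun z => ∑' i, deriv (f i) z) =ᶠ[𝓝 0] deriv fun z => ∑' i, f i z := by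
        filter_upwards [Metric.ball_mem_nhds (0 : ℂ) hR] with z hz
        exact (Complex.hasSum_deriv_of_summable_norm hu hf Metric.isOpen_ball hb hz).tsum_eq
      rwa [heq.iteratedDeriv_eq] at h
    · intro i z hz
      have hzR : ‖z‖ < R / 2 := by simpa using hz
      have hcl : Metric.closedBall z (R / 4) ⊆ Metric.ball 0 R := by
        intro w hw
        have h1 : ‖w - z‖ ≤ R / 4 := by simpa [dist_eq_norm] using hw
        have h2 := norm_le_norm_add_norm_sub' w z
        simp only [mem_ball_zero_iff]
        linarith
      exact Complex.norm_deriv_le_of_forall_mem_sphere_norm_le (by positivity)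
        (((hf i).mono hcl).diffContOnCl_ball subset_rfl)
        fun w hw => hb i w (hcl (Metric.sphere_subset_closedBall hw))

theorem iteratedDeriv_comp_mul_left_complex (c : ℂ) (k : ℕ) :
    ∀ f : ℂ → ℂ, ∀ z, iteratedDeriv k (fun z => f (c * z)) z = c ^ k * iteratedDeriv k f (c * z) := by
  induction k with
  | zero => simp
  | succ k ih =>
    intro f z
    have h : deriv (fun z => f (c * z)) = fun z => (fun w => c * deriv f w) (c * z) := by
      ext z
      simp [deriv_comp_mul_left]
    rw [iteratedDeriv_succ', h, ih fun w => c * deriv f w, iteratedDeriv_const_mul_field, iteratedDeriv_succ', pow_succ]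
    ring

/-- If `F` is real on the real axis near 0, its complex derivative there is real and equals the
derivative of the restriction; then induct. -/
theorem iteratedDeriv_ofReal_eq {k : ℕ} : ∀ {F : ℂ → ℂ} {f : ℝ → ℝ}, AnalyticAt ℂ F 0 →
    (∀ᶠ t : ℝ in 𝓝 0, F t = f t) → iteratedDeriv k F 0 = iteratedDeriv k f 0 := by
  induction k with
  | zero =>
    intro F f _ h
    simpa using h.self_of_nhds
  | succ k ih =>
    intro F f hF h
    rw [iteratedDeriv_succ', iteratedDeriv_succ']
    apply ih hF.deriv
    have hct : Tendsto (fun t : ℝ => (t : ℂ)) (𝓝 0) (𝓝 0) := by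
      simpa using (Complex.continuous_ofReal.tendsto 0)
    filter_upwards [hct.eventually hF.eventually_analyticAt, h.eventually_nhds] with t hFt hft
    have hd := hFt.differentiableAt.hasDerivAt
    have h1 : HasDerivAt f (deriv F t).re t := by
      refine hd.real_of_complex.congr_of_eventuallyEq ?_
      filter_upwards [hft] with s hs
      rw [hs, Complex.ofReal_re]
    have h2 := hd.comp_ofReal
    have h3 : HasDerivAt (fun s : ℝ => F s) ((deriv F t).re : ℂ) t := by
      refine h1.ofReal_comp.congr_of_eventuallyEq ?_
      filter_upwards [hft] with s hs using hs
    rw [h1.deriv]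
    exact h2.unique h3

end Derivatives

/-! ### Cumulants from the complex logarithm. -/

section CGF
variable {Ω : Type*} [MeasurableSpace Ω] {P : Measure Ω} {Y : Ω → ℝ}
  {r : ℝ} {L : ℂ → ℂ}

theorem IsComplexCGF.zero_mem_interior (hL : IsComplexCGF P Y r L) (hr : 0 < r) :
    0 ∈ interior (integrableExpSet Y P) := by
  rw [mem_interior_iff_mem_nhds]
  filter_upwards [Metric.ball_mem_nhds (0 : ℝ) hr] with t ht
  have h := (hL.integrable_exp t (by simpa using ht)).re
  refine h.congr (Eventually.of_forall fun ω => ?_)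
  beta_reduce
  rw [← Complex.ofReal_mul, ← Complex.ofReal_exp]
  exact Complex.ofReal_re _

/-- The relation `exp L = MGF` fixes `L` only modulo `2πi`. Near 0 one has `‖L‖ < 1 < π`, which
forces the principal branch and hence the real logarithm. -/
theorem IsComplexCGF.eventually_eq_cgf (hL : IsComplexCGF P Y r L) (hr : 0 < r) :
    ∀ᶠ t : ℝ in 𝓝 0, L t = cgf Y P t := by
  have h0 : (0 : ℂ) ∈ Metric.ball (0 : ℂ) r := by simpa
  have hct : Tendsto (fun t : ℝ => (t : ℂ)) (𝓝 0) (𝓝 0) := by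
    simpa using (Complex.continuous_ofReal.tendsto 0)
  have hLc : Tendsto (fun t : ℝ => L t) (𝓝 0) (𝓝 0) := by
    have := (hL.analytic 0 h0).continuousAt.tendsto
    rw [hL.map_zero] at this
    exact this.comp hct
  have hsmall : ∀ᶠ t : ℝ in 𝓝 0, ‖L t‖ < 1 := by
    simpa using hLc.eventually (Metric.ball_mem_nhds (0 : ℂ) one_pos)
  filter_upwards [hsmall, hct.eventually (Metric.ball_mem_nhds (0 : ℂ) hr)] with t ht htr
  have him := (Complex.abs_im_le_norm (L t)).trans_lt ht
  rw [abs_lt] at him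
  have hpi := Real.pi_gt_three
  rw [← Complex.log_exp (x := L t) (by linarith) (by linarith), hL.exp_eq _ htr, complexMGF_ofReal,
    cgf, Complex.ofReal_log mgf_nonneg]

theorem IsComplexCGF.iteratedDeriv_eq (hL : IsComplexCGF P Y r L) (hr : 0 < r) (k : ℕ) :
    iteratedDeriv k L 0 = cumulant P Y k :=
  iteratedDeriv_ofReal_eq (hL.analytic 0 (by simpa)) (hL.eventually_eq_cgf hr)

variable [IsProbabilityMeasure P]

theorem IsComplexCGF.cumulant_one (hL : IsComplexCGF P Y r L) (hr : 0 < r) :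
    cumulant P Y 1 = ∫ ω, Y ω ∂P := by
  rw [cumulant, iteratedDeriv_one, deriv_cgf_zero (hL.zero_mem_interior hr)]
  simp

theorem IsComplexCGF.cumulant_two (hL : IsComplexCGF P Y r L) (hr : 0 < r) (hY : Measurable Y) :
    cumulant P Y 2 = Var[Y; P] := by
  have h := hL.zero_mem_interior hr
  rw [cumulant, iteratedDeriv_two_cgf_eq_integral h, deriv_cgf_zero h,
    variance_eq_integral hY.aemeasurable]
  simp

end CGF

/-! ### The moment generating function of the infinite sum. -/

section Limit
variable {Ω : Type*} [MeasurableSpace Ω] {P : Measure Ω}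

theorem iIndepFun_complexMGF_sum {ι : Type*} {X : ι → Ω → ℝ} (hX : iIndepFun X P)
    (hm : ∀ i, Measurable (X i)) (s : Finset ι) (z : ℂ) :
    complexMGF (fun ω => ∑ i ∈ s, X i ω) P z = ∏ i ∈ s, complexMGF (X i) P z := by
  have h := (hX.precomp (g := ((↑) : s → ι)) Subtype.val_injective).integral_fun_prod_comp
    (f := fun _ y => Complex.exp (z * (y : ℝ))) (fun i => (hm i).aemeasurable)
    (fun i => (by fun_prop : Continuous _).aestronglyMeasurable)
  simp only [complexMGF]
  rw [← Finset.prod_coe_sort, ← h]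
  congr 1
  ext ω
  rw [← Complex.exp_sum, Finset.sum_coe_sort s (fun i => z * (X i ω : ℂ)), ← Finset.mul_sum]
  push_cast
  rfl

theorem IsFieldSum.aemeasurable {d : ℕ} {X : (Fin d → ℤ) → Ω → ℝ} {S : Ω → ℝ}
    (hX : ∀ j, Measurable (X j)) (hS : IsFieldSum P X S) :
    AEMeasurable S P := by
  obtain ⟨ns, -, hns⟩ := TendstoInMeasure.exists_seq_tendsto_ae hS
  exact aemeasurable_of_tendsto_metrizable_ae atTop
    (fun n => (Finset.measurable_fun_sum _ fun j _ => hX j).aemeasurable) hns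

variable [IsProbabilityMeasure P]

/-- A sequence bounded in `L²` which converges almost everywhere converges in mean. -/
theorem tendsto_integral_of_bounded_sq {g : ℕ → Ω → ℂ} {g' : Ω → ℂ} {B : ℝ}
    (hg : ∀ n, AEStronglyMeasurable (g n) P)
    (hint : ∀ n, Integrable (fun ω => ‖g n ω‖ ^ 2) P) (hB : ∀ n, ∫ ω, ‖g n ω‖ ^ 2 ∂P ≤ B)
    (hlim : ∀ᵐ ω ∂P, Tendsto (fun n => g n ω) atTop (𝓝 (g' ω))) :
    Tendsto (fun n => ∫ ω, g n ω ∂P) atTop (𝓝 (∫ ω, g' ω ∂P)) := by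
  have hB0 : 0 ≤ B := (integral_nonneg fun ω => sq_nonneg _).trans (hB 0)
  have hUI : UniformIntegrable g 1 P := by
    refine uniformIntegrable_of le_rfl ENNReal.one_ne_top hg fun ε hε => ?_
    -- Above this level `‖g‖ ≤ ε/(B + 1) * ‖g‖²`; using `B + 1` avoids division by zero.
    refine ⟨((B + 1) / ε).toNNReal, fun n => ?_⟩
    rw [eLpNorm_one_eq_lintegral_enorm]
    calc ∫⁻ ω, ‖({x | ((B + 1) / ε).toNNReal ≤ ‖g n x‖₊}.indicator (g n)) ω‖ₑ ∂P
        ≤ ∫⁻ ω, ENNReal.ofReal (ε / (B + 1) * ‖g n ω‖ ^ 2) ∂P := by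
          apply lintegral_mono
          intro ω
          beta_reduce
          by_cases hω : ((B + 1) / ε).toNNReal ≤ ‖g n ω‖₊
          · rw [Set.indicator_of_mem (by exact hω), ← ofReal_norm]
            apply ENNReal.ofReal_le_ofReal
            have h1 : (B + 1) / ε ≤ ‖g n ω‖ := Real.toNNReal_le_iff_le_coe.1 hω
            have h2 : 1 ≤ ε / (B + 1) * ‖g n ω‖ := by
              calc (1 : ℝ) = ε / (B + 1) * ((B + 1) / ε) := by field_simp
                _ ≤ _ := by gcongr
            nlinarith [norm_nonneg (g n ω)]
          · rw [Set.indicator_of_notMem (by exact hω)]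
            simp
      _ = ENNReal.ofReal (ε / (B + 1) * ∫ ω, ‖g n ω‖ ^ 2 ∂P) := by
          rw [← integral_const_mul, ofReal_integral_eq_lintegral_ofReal ((hint n).const_mul _)]
          exact Eventually.of_forall fun ω => by positivity
      _ ≤ ENNReal.ofReal ε := by
          apply ENNReal.ofReal_le_ofReal
          calc ε / (B + 1) * ∫ ω, ‖g n ω‖ ^ 2 ∂P ≤ ε / (B + 1) * (B + 1) := by
                gcongr
                linarith [hB n]
            _ = ε := by field_simp
  have hg' := hUI.memLp_of_ae_tendsto hlim
  refine tendsto_integral_of_L1' g' hg'.1 (Eventually.of_forall fun n => ?_)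
    (tendsto_Lp_finite_of_tendsto_ae le_rfl ENNReal.one_ne_top hg hg' hUI.unifIntegrable hlim)
  exact memLp_one_iff_integrable.1 (hUI.memLp n)

variable {d : ℕ} {X : (Fin d → ℤ) → Ω → ℝ} {S : Ω → ℝ} {H : ℝ} {L : (Fin d → ℤ) → ℂ → ℂ}
  {c : (Fin d → ℤ) → ℝ}

/-- Along an almost surely convergent subsequence of cubes, the limit passes under the expectation
once `exp (z S_m)` is bounded in L². Its squared modulus is `exp (2 Re z S_m)`, of expectation at
most `exp (∑ c j)` provided `|2 Re z| < H`; hence the restriction to the disc of radius `H / 2`. -/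
theorem complexMGF_fieldSum (hX : ∀ j, Measurable (X j)) (hind : iIndepFun X P)
    (hL : ∀ j, IsComplexCGF P (X j) H (L j)) (hS : IsFieldSum P X S) (hc : Summable c)
    (hLc : ∀ j, ∀ z ∈ Metric.ball (0 : ℂ) H, ‖L j z‖ ≤ c j) {z : ℂ}
    (hz : z ∈ Metric.ball (0 : ℂ) (H / 2)) :
    complexMGF S P z = Complex.exp (∑' j, L j z) := by
  have hzH : ‖z‖ < H / 2 := by simpa using hz
  have hc0 : ∀ j, 0 ≤ c j := fun j => (norm_nonneg _).trans
    (hLc j 0 (by simp; linarith [norm_nonneg z]))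
  have hzball : z ∈ Metric.ball (0 : ℂ) H := by simp; linarith [norm_nonneg z]
  have hpart : ∀ s : Finset (Fin d → ℤ), ∀ w ∈ Metric.ball (0 : ℂ) H,
      complexMGF (fun ω => ∑ j ∈ s, X j ω) P w = Complex.exp (∑ j ∈ s, L j w) := by
    intro s w hw
    rw [iIndepFun_complexMGF_sum hind hX, Complex.exp_sum]
    exact Finset.prod_congr rfl fun j _ => ((hL j).exp_eq w hw).symm
  set b : ℝ := 2 * z.re with hb
  have hbH : (b : ℂ) ∈ Metric.ball (0 : ℂ) H := by
    have := Complex.abs_re_le_norm z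
    rw [mem_ball_zero_iff, Complex.norm_real, Real.norm_eq_abs, hb, abs_mul, abs_two]
    linarith
  have hmgf : ∀ s : Finset (Fin d → ℤ), ∃ w : ℂ, ‖w‖ ≤ ∑' j, c j ∧
      mgf (fun ω => ∑ j ∈ s, X j ω) P b = Real.exp w.re := by
    intro s
    refine ⟨∑ j ∈ s, L j b, ?_, ?_⟩
    · refine (norm_sum_le _ _).trans ?_
      exact (Finset.sum_le_sum fun j _ => hLc j b hbH).trans
        (hc.sum_le_tsum s fun j _ => hc0 j)
    · rw [← Complex.norm_exp, ← hpart s b hbH, complexMGF_ofReal, Complex.norm_real,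
        Real.norm_eq_abs, abs_of_nonneg mgf_nonneg]
  have hsq : ∀ (s : Finset (Fin d → ℤ)) (ω : Ω),
      ‖Complex.exp (z * ((∑ j ∈ s, X j ω : ℝ) : ℂ))‖ ^ 2 = Real.exp (b * ∑ j ∈ s, X j ω) := by
    intro s ω
    rw [Complex.norm_exp, ← Real.exp_nat_mul, Complex.re_mul_ofReal, hb]
    congr 1
    push_cast
    ring
  obtain ⟨ns, hns, hae⟩ := TendstoInMeasure.exists_seq_tendsto_ae hS
  have hlim := tendsto_integral_of_bounded_sq (P := P)
    (g := fun k ω => Complex.exp (z * ((∑ j ∈ latticeCube d (ns k), X j ω : ℝ) : ℂ)))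
    (g' := fun ω => Complex.exp (z * (S ω : ℂ))) (B := Real.exp (∑' j, c j)) ?_ ?_ ?_ ?_
  · have hlim2 : Tendsto (fun k => Complex.exp (∑ j ∈ latticeCube d (ns k), L j z)) atTop
        (𝓝 (Complex.exp (∑' j, L j z))) := by
      have hsum : HasSum (fun j => L j z) (∑' j, L j z) :=
        (Summable.of_norm_bounded hc fun j => hLc j z hzball).hasSum
      exact (Complex.continuous_exp.tendsto _).comp
        (hsum.comp ((tendsto_latticeCube d).comp hns.tendsto_atTop))
    refine tendsto_nhds_unique hlim (hlim2.congr fun k => ?_)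
    rw [← hpart _ z hzball]
    rfl
  · intro k
    have : Measurable fun ω => ∑ j ∈ latticeCube d (ns k), X j ω :=
      Finset.measurable_fun_sum _ fun j _ => hX j
    exact (by fun_prop : Measurable _).aestronglyMeasurable
  · intro k
    simp_rw [hsq]
    obtain ⟨w, -, hw⟩ := hmgf (latticeCube d (ns k))
    -- The expectation equals a positive exponential, whereas a non-integrable function has integral
    -- 0.
    by_contra hcon
    exact (Real.exp_pos w.re).ne' (hw ▸ integral_undef hcon)
  · intro k
    simp_rw [hsq]
    obtain ⟨w, hwc, hw⟩ := hmgf (latticeCube d (ns k))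
    refine (le_of_eq hw).trans (Real.exp_le_exp.2 ?_)
    exact (Complex.re_le_norm w).trans hwc
  · filter_upwards [hae] with ω hω
    have h1 : Continuous fun y : ℝ => Complex.exp (z * (y : ℂ)) := by fun_prop
    exact (h1.tendsto _).comp hω

end Limit

/-! ### Normalisation and conclusion. -/

theorem iteratedDeriv_sub_sq_div_two {f : ℂ → ℂ} (hf : AnalyticAt ℂ f 0)
    (h : ∀ k < 4, iteratedDeriv k f 0 = if k = 2 then 1 else 0) :
    ∀ k < 4, iteratedDeriv k (fun z => f z - z ^ 2 / 2) 0 = 0 := by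
  intro k hk
  rw [iteratedDeriv_fun_sub hf.contDiffAt (by fun_prop), h k hk, iteratedDeriv_div_const]
  interval_cases k <;> simp

/-- Large deviations for the sum of a single random field, uniformly over random fields. -/
theorem exists_abs_normalizedCDF_sub_stdNormalCDF_le (A κ : ℝ) (hA : 0 ≤ A) (hκ : 0 ≤ κ) :
    ∃ C : ℝ, ∀ {Ω : Type*} [MeasurableSpace Ω] (P : Measure Ω) [IsProbabilityMeasure P]
      (d : ℕ) (X : (Fin d → ℤ) → Ω → ℝ) (S : Ω → ℝ) (H : ℝ) (L : (Fin d → ℤ) → ℂ → ℂ)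
      (c : (Fin d → ℤ) → ℝ), (∀ j, Measurable (X j)) → (∀ j, ∫ ω, X j ω ∂P = 0) →
      iIndepFun X P → 0 < H → (∀ j, IsComplexCGF P (X j) H (L j)) → IsFieldSum P X S →
      (∀ j, ∀ z ∈ Metric.ball (0 : ℂ) H, ‖L j z‖ ≤ c j) → Summable c →
      0 < fieldVariance P X → ∑' j, c j ≤ A * (fieldVariance P X * H ^ 2) →
      ∑' j, cumulant P (X j) 3 = 0 → 4096 * κ ≤ fieldVariance P X * H ^ 2 →
      ∀ x : ℝ, 0 ≤ x → x ^ 3 ≤ κ * (H * √(fieldVariance P X)) →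
      |normalizedCDF P S (fieldVariance P X) x - stdNormalCDF x| ≤
        C * (Real.exp (-x ^ 2 / 2) / (H * √(fieldVariance P X))) := by
  -- With `T = Hσ/2` one has `T² = B H²/4`. So `A B H² = 4 A T²`, the subtracted `w²/2` costs at
  -- most `T²`, `κHσ = 2κT`, and `512 * 2κ ≤ T²` reads `4096 κ ≤ B H²`. The factor 2 in `2 * C` is
  -- `1/T = 2/(Hσ)`.
  obtain ⟨C, hC, hcore⟩ := exists_abs_measureReal_Iio_sub_stdNormalCDF_le (4 * A + 1) (2 * κ)
    (by positivity) (by positivity)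
  refine ⟨2 * C, ?_⟩
  intro Ω _ P _ d X S H L c hX hmean hind hH hL hS hLc hc hB hcA h3 hκB x hx hxκ
  set B := fieldVariance P X with hBdef
  set σ := √B with hσ
  have hσ0 : 0 < σ := Real.sqrt_pos.2 hB
  have hσ2 : σ ^ 2 = B := Real.sq_sqrt hB.le
  have hSm := hS.aemeasurable hX
  set Λ : ℂ → ℂ := fun z => ∑' j, L j z with hΛ
  have hLd : ∀ j, DifferentiableOn ℂ (L j) (Metric.ball 0 H) := fun j =>
    (hL j).analytic.differentiableOn
  have hΛd : DifferentiableOn ℂ Λ (Metric.ball 0 H) :=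
    Complex.differentiableOn_tsum_of_summable_norm hc hLd Metric.isOpen_ball hLc
  have hsum : ∀ k, HasSum (fun j => (cumulant P (X j) k : ℂ)) (iteratedDeriv k Λ 0) := by
    intro k
    have := hasSum_iteratedDeriv_zero k hH hc hLd hLc
    simpa only [fun j => (hL j).iteratedDeriv_eq hH k] using this
  -- Order 1 is the mean-zero hypothesis, order 2 the definition of `B`, order 3 the vanishing of
  -- the sum of the `γ₃`.
  have hΛ0 : ∀ k < 4, iteratedDeriv k Λ 0 = if k = 2 then (B : ℂ) else 0 := by
    intro k hk
    interval_cases k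
    · simp [hΛ, (hL _).map_zero]
    · have := hsum 1
      simp only [fun j => (hL j).cumulant_one hH, hmean] at this
      simpa using this.unique hasSum_zero
    · rw [← (hsum 2).tsum_eq, ← Complex.ofReal_tsum]
      simp only [fun j => (hL j).cumulant_two hH (hX j)]
      simp [hBdef, fieldVariance]
    · rw [← (hsum 3).tsum_eq, ← Complex.ofReal_tsum, h3]
      simp
  set T := H * σ / 2 with hT
  have hT0 : 0 < T := by positivity
  have hT2 : T ^ 2 = B * H ^ 2 / 4 := by rw [hT, ← hσ2]; ring
  have hσc : (σ : ℂ) ≠ 0 := by exact_mod_cast hσ0.ne'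
  have hscale : ∀ w ∈ Metric.ball (0 : ℂ) T, (σ : ℂ)⁻¹ * w ∈ Metric.ball (0 : ℂ) (H / 2) := by
    intro w hw
    rw [mem_ball_zero_iff] at hw ⊢
    rw [norm_mul, norm_inv, Complex.norm_real, Real.norm_eq_abs, abs_of_pos hσ0,
      inv_mul_lt_iff₀ hσ0]
    rw [hT] at hw
    linarith
  have hsub : Metric.ball (0 : ℂ) (H / 2) ⊆ Metric.ball 0 H := Metric.ball_subset_ball (by linarith)
  set f : ℂ → ℂ := fun w => Λ ((σ : ℂ)⁻¹ * w) with hf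
  have hfd : DifferentiableOn ℂ f (Metric.ball 0 T) :=
    hΛd.comp (by fun_prop) fun w hw => hsub (hscale w hw)
  have hfan : AnalyticAt ℂ f 0 :=
    hfd.analyticAt (Metric.ball_mem_nhds (0 : ℂ) hT0)
  have hf0 : ∀ k < 4, iteratedDeriv k f 0 = if k = 2 then 1 else 0 := by
    intro k hk
    rw [hf, iteratedDeriv_comp_mul_left_complex, mul_zero, hΛ0 k hk]
    split_ifs with h
    · rw [h, ← hσ2]
      push_cast
      field_simp
    · simp
  have hmeas : AEMeasurable (fun ω => S ω / σ) P := hSm.div_const σ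
  have := Measure.isProbabilityMeasure_map (μ := P) hmeas
  have key := hcore (P.map fun ω => S ω / σ) (fun w => f w - w ^ 2 / 2) T x hT0
    (by rw [hT2]; linarith) (hfd.sub (by fun_prop)) ?_ (iteratedDeriv_sub_sq_div_two hfan hf0) ?_ hx
    (by rw [hT]; linarith)
  · have h1 : (P.map fun ω => S ω / σ).real (Set.Iio x) = normalizedCDF P S B x := by
      rw [normalizedCDF, measureReal_def, Measure.map_apply_of_aemeasurable hmeas measurableSet_Iio,
        ← measureReal_def, ← hσ]
      congr 1
      ext ω
      simp only [Set.mem_preimage, Set.mem_Iio, Set.mem_ofPred_eq]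
      rw [div_lt_iff₀ hσ0]
    rw [h1] at key
    refine key.trans (le_of_eq ?_)
    rw [hT]
    field_simp
  · intro w hw
    have h1 : ‖f w‖ ≤ A * (B * H ^ 2) :=
      (tsum_of_norm_bounded hc.hasSum fun j => hLc j _ (hsub (hscale w hw))).trans hcA
    have h2 : ‖w ^ 2 / 2‖ ≤ T ^ 2 := by
      rw [mem_ball_zero_iff] at hw
      rw [norm_div, norm_pow]
      have : ‖w‖ ^ 2 ≤ T ^ 2 := by gcongr
      simp
      linarith [sq_nonneg ‖w‖]
    refine (norm_sub_le _ _).trans ?_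
    nlinarith
  · intro w hw
    rw [add_sub_cancel, hf]
    simp only [hΛ]
    rw [← complexMGF_fieldSum hX hind hL hS hc hLc (hscale w hw), complexMGF_id_map hmeas, complexMGF,
      complexMGF]
    congr 1
    ext ω
    congr 1
    push_cast
    field_simp

theorem mainTheorem5 {Ω : Type*} [MeasurableSpace Ω] (P : Measure Ω) [IsProbabilityMeasure P]
    (d : ℕ) (X : ℕ → (Fin d → ℤ) → Ω → ℝ) (S : ℕ → Ω → ℝ) (H : ℕ → ℝ)
    (L : ℕ → (Fin d → ℤ) → ℂ → ℂ) (c : ℕ → (Fin d → ℤ) → ℝ)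
    (hX_meas : ∀ n j, Measurable (X n j))
    (hX_mean : ∀ n j, ∫ ω, X n j ω ∂P = 0)
    (hX_indep : ∀ n, iIndepFun (X n) P)
    (hH : ∀ n, 0 < H n)
    (hL : ∀ n j, IsComplexCGF P (X n j) (H n) (L n j))
    (hB : ∀ n, Summable fun j => Var[X n j; P])
    (hS : ∀ n, IsFieldSum P (X n) (S n))
    (hc_nonneg : ∀ n j, 0 ≤ c n j)
    (hLc : ∀ n j, ∀ z ∈ Metric.ball (0 : ℂ) (H n), ‖L n j z‖ ≤ c n j)
    (hBH : Tendsto (fun n => fieldVariance P (X n) * H n ^ 2) atTop atTop)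
    (hc_sum : ∀ n, Summable (c n))
    (hC : (fun n => ∑' j, c n j) =O[atTop] fun n => fieldVariance P (X n) * H n ^ 2)
    (hγ : ∀ n, ∑' j, cumulant P (X n j) 3 = 0) :
    ∀ K : ℝ, ∃ C : ℝ, ∀ᶠ n in atTop, ∀ x : ℝ, 0 ≤ x →
      x ≤ K * (H n * √(fieldVariance P (X n))) ^ ((1 : ℝ) / 3) →
      |normalizedCDF P (S n) (fieldVariance P (X n)) x - stdNormalCDF x| ≤
        C * (Real.exp (-x ^ 2 / 2) / (H n * √(fieldVariance P (X n)))) := by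
  intro K
  obtain ⟨A, hA, hCA⟩ := hC.exists_nonneg
  -- Cubing `x ≤ |K| (H√B)^(1/3)` gives `x³ ≤ |K|³ H√B`, so `κ = |K|³`; the absolute value covers
  -- negative `K`.
  obtain ⟨C, hmain⟩ := exists_abs_normalizedCDF_sub_stdNormalCDF_le A (|K| ^ 3) hA (by positivity)
  refine ⟨C, ?_⟩
  filter_upwards [hCA.bound, hBH.eventually_ge_atTop (4096 * |K| ^ 3), hBH.eventually_gt_atTop 0]
    with n hn hn1 hn2 x hx hxK
  have hB0 : 0 < fieldVariance P (X n) := pos_of_mul_pos_left hn2 (sq_nonneg _)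
  have hT0 : 0 ≤ H n * √(fieldVariance P (X n)) := mul_nonneg (hH n).le (Real.sqrt_nonneg _)
  refine hmain P d (X n) (S n) (H n) (L n) (c n) (hX_meas n) (hX_mean n) (hX_indep n) (hH n) (hL n)
    (hS n) (hLc n) (hc_sum n) hB0 ?_ (hγ n) hn1 x hx ?_
  · rw [Real.norm_eq_abs, Real.norm_eq_abs, abs_of_pos hn2] at hn
    exact (le_abs_self _).trans hn
  · have h1 : x ≤ |K| * (H n * √(fieldVariance P (X n))) ^ ((1 : ℝ) / 3) :=
      hxK.trans (mul_le_mul_of_nonneg_right (le_abs_self K) (by positivity))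
    calc x ^ 3 ≤ (|K| * (H n * √(fieldVariance P (X n))) ^ ((1 : ℝ) / 3)) ^ 3 := by gcongr
      _ = |K| ^ 3 * (H n * √(fieldVariance P (X n))) := by
        rw [mul_pow, ← Real.rpow_mul_natCast hT0]
        norm_num
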